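/- Let $q=2^e$ with $q\equiv 8\pmod{10}$, and put $n=\frac{q^2+1}{5}$, $r=q+1$, $s=\frac{q^2-q}{2}$. Let $\alpha\in\mathbb F_{q^2}$ be a primitive $r$-th root of unity and let $\delta$ be a primitive $rn$-th root of unity in an extension field of $\mathbb F_{q^2}$ with $\delta^n=\alpha$. For an $\alpha$-constacyclic code $\mathcal C\subseteq\mathbb F_{q^2}^n$ with monic generator polynomial $g\mid x^n-\alpha$, the defining set is $\{i\in\{1+rj: 0\le j\le n-1\} : g(\delta^i)=0\}$, read modulo $rn$; let $C_i=\{iq^{2j} \bmod rn : j\in\mathbb Z\}$ be the $q^2$-cyclotomic coset of $i$ modulo $rn$. Let $\lambda$ be an integer with $1\le\lambda\le\frac{q+2}{5}$. Then there is an $\alpha$-constacyclic code of length $n$ over $\mathbb F_{q^2}$ with defining set $$Z=\bigcup_{j=0}^{\frac{3q-14}{10}+\lambda} C_{s-rj}.$$ For each such code $\mathcal C$, put $$k=n-\tfrac25(3q-14)-4\lambda,\qquad d=\tfrac{3q-14}{5}+2\lambda+3 .$$ Then $\mathcal C$ has minimum distance $d$, every parity check matrix $H$ of $\mathcal C$ satisfies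 $\operatorname{rank}(HH^*)=4$, where $H^*$ is the transpose of $H$ with entries raised to the power $q$, and $k=2\dim\mathcal C-n+4$. Moreover there exists an entanglement-assisted quantum error-correcting code with parameters $$[[\,n,\;k,\;d;\;4\,]]_q ,$$ that is, a code that encodes $k$ qudits of dimension $q$ into $n$ such qudits with the help of $4$ maximally entangled pairs shared in advance, and whose minimum distance with respect to errors on the $n$ transmitted qudits is exactly $d$. It is an EAQMDS code, i.e. it attains the entanglement-assisted Singleton bound: $n+4-k=2(d-1)$; and $d\le\frac{n+2}{2}$ holds except in the single case $q=8$, $\lambda=2$ (parameters $[[13,1,9;4]]_8$). -/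

import Mathlib

open scoped Kronecker Polynomial

namespace EAQ

/-! ### Constacyclic codes over `F`, where `F` is the field with `q ^ 2` elements -/

section Classical

variable {F : Type*} [Field F]

/-- The polynomial `c₀ + c₁ x + ⋯ + c_{n-1} x ^ (n-1)` of a word. -/
noncomputable def wordPoly {n : ℕ} (c : Fin n → F) : F[X] :=
  ∑ i : Fin n, Polynomial.C (c i) * Polynomial.X ^ (i : ℕ)

/-- The constacyclic shift `(α c_{n-1}, c₀, …, c_{n-2})` of a word. -/
def constacyclicShift (α : F) {n : ℕ} (c : Fin n → F) : Fin n → F := fun i =>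
  if (i : ℕ) = 0 then α * c ⟨n - 1, by have := i.isLt; omega⟩
  else c ⟨i - 1, by have := i.isLt; omega⟩

/-- A linear code is `α`-constacyclic if it is closed under the constacyclic shift. -/
def IsConstacyclic (α : F) {n : ℕ} (C : Submodule F (Fin n → F)) : Prop :=
  ∀ c ∈ C, constacyclicShift α c ∈ C

/-- `g` is the monic generator polynomial of the code: `g` divides `x ^ n - α` and the codewords
are the words whose class modulo `x ^ n - α` lies in the ideal generated by `g`. -/
def IsGeneratorPoly (α : F) {n : ℕ} (C : Submodule F (Fin n → F)) (g : F[X]) : Prop :=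
  g.Monic ∧ g ∣ Polynomial.X ^ n - Polynomial.C α ∧ ∀ c : Fin n → F, c ∈ C ↔ g ∣ wordPoly c

/-- `𝒪_{rn} = {1 + r j | 0 ≤ j ≤ n - 1}`, as residues modulo `r n`. -/
def exponentSet (r n : ℕ) : Set (ZMod (r * n)) :=
  {i | ∃ j : ℕ, j < n ∧ i = ((1 + r * j : ℕ) : ZMod (r * n))}

/-- `Z` is the defining set of the `α`-constacyclic code `C = ⟨g⟩` with respect to `δ`, a primitive
`r n`-th root of unity in an extension field: the set of `i ∈ 𝒪_{rn}` with `g (δ ^ i) = 0`. -/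
def HasDefiningSet {K : Type*} [Field K] [Algebra F K] (α : F) (δ : K) (r : ℕ) {n : ℕ}
    (C : Submodule F (Fin n → F)) (Z : Set (ZMod (r * n))) : Prop :=
  ∃ g : F[X], IsGeneratorPoly α C g ∧
    Z = {i | i ∈ exponentSet r n ∧ Polynomial.aeval (δ ^ i.val) g = 0}

/-- The `Q`-cyclotomic coset of `i` modulo `N` (for `Q` coprime to `N`, nonnegative exponents
already give the whole orbit). -/
def cyclotomicCoset (Q N : ℕ) (i : ℤ) : Set (ZMod N) :=
  {x | ∃ j : ℕ, x = (i : ZMod N) * (Q : ZMod N) ^ j}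

/-- The union of the `q ^ 2`-cyclotomic cosets of `s - r j` modulo `r n`, for `0 ≤ j ≤ J`. -/
def cosetUnion (q r n : ℕ) (s : ℤ) (J : ℕ) : Set (ZMod (r * n)) :=
  ⋃ j ∈ Set.Icc 0 J, cyclotomicCoset (q ^ 2) (r * n) (s - r * j)

/-- `d` is the minimum weight of the nonzero codewords of `C`. -/
def IsMinWeight [DecidableEq F] {n : ℕ} (C : Submodule F (Fin n → F)) (d : ℕ) : Prop :=
  IsLeast {w : ℕ | ∃ c ∈ C, c ≠ 0 ∧ hammingNorm c = w} d

/-- `H` is a parity check matrix of `C`: its rows are linearly independent and `C` is the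
kernel of `H`. -/
def IsParityCheck {n m : ℕ} (C : Submodule F (Fin n → F)) (H : Matrix (Fin m) (Fin n) F) : Prop :=
  LinearIndependent F H.row ∧ ∀ c : Fin n → F, c ∈ C ↔ H.mulVec c = 0

/-- The conjugate transpose `H^*` over the field with `q ^ 2` elements; conjugation is
`x ↦ x ^ q`. -/
def hermTranspose (q : ℕ) {m n : ℕ} (H : Matrix (Fin m) (Fin n) F) : Matrix (Fin n) (Fin m) F :=
  fun i j => H j i ^ q

end Classical

/-! ### Entanglement-assisted quantum codes

The standard basis of `m` qudits of dimension `q`, that is of `(ℂ^q)^{⊗ m}`, is indexed by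
`Fin m → Fin q`; operators are matrices in these bases. -/

section Quantum

/-- An encoder of `k` qudits into `n` qudits with the help of `c` maximally entangled pairs of
qudits: an isometry from the sender's `k` message qudits and her `c` halves of the pairs to the `n`
qudits that are sent through the channel. The receiver holds the other `c` halves. -/
structure EAEncoder (q n k c : ℕ) where
  V : Matrix (Fin n → Fin q) ((Fin k → Fin q) × (Fin c → Fin q)) ℂ
  isometry : V.conjTranspose * V = 1

namespace EAEncoder

variable {q n k c : ℕ}

/-- The encoding as seen by the receiver, on the `n` channel qudits and his `c` noiseless qudits:
`|m⟩ ↦ (V ⊗ 1) (|m⟩ ⊗ |Φ⟩)`, where `|Φ⟩ = q ^ (-c/2) ∑_b |b⟩ ⊗ |b⟩`. -/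
noncomputable def encoding (𝒬 : EAEncoder q n k c) :
    Matrix ((Fin n → Fin q) × (Fin c → Fin q)) (Fin k → Fin q) ℂ :=
  fun x m => 𝒬.V x.1 (m, x.2) / ((Real.sqrt ((q : ℝ) ^ c) : ℝ) : ℂ)

/-- The operator `E` on `n` qudits acts only on the qudits in `T`: it is `M ⊗ 1` for an operator
`M` on the qudits in `T`. -/
def ActsOn (T : Finset (Fin n)) (E : Matrix (Fin n → Fin q) (Fin n → Fin q) ℂ) : Prop :=
  ∃ M : Matrix (T → Fin q) (T → Fin q) ℂ, ∀ x y : Fin n → Fin q,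
    ((∀ i, i ∉ T → x i = y i) → E x y = M (fun i => x i) (fun i => y i)) ∧
    ((¬ ∀ i, i ∉ T → x i = y i) → E x y = 0)

/-- The code detects the error `E` on the channel qudits (Knill–Laflamme condition): with `P` the
projection onto the code space, `P (E ⊗ 1) P` is a multiple of `P`. It is written here with the
isometry `W = encoding`, for which `P = W W^*`. -/
def Detects (𝒬 : EAEncoder q n k c) (E : Matrix (Fin n → Fin q) (Fin n → Fin q) ℂ) : Prop :=
  ∃ z : ℂ, 𝒬.encoding.conjTranspose *
    (E ⊗ₖ (1 : Matrix (Fin c → Fin q) (Fin c → Fin q) ℂ)) * 𝒬.encoding = z • 1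

/-- The minimum distance is `d`: all errors on fewer than `d` of the channel qudits are detected,
and some error on `d` of them is not. -/
def HasMinDistance (𝒬 : EAEncoder q n k c) (d : ℕ) : Prop :=
  IsLeast {w : ℕ | ∃ T : Finset (Fin n), T.card = w ∧
    ∃ E : Matrix (Fin n → Fin q) (Fin n → Fin q) ℂ, ActsOn T E ∧ ¬ 𝒬.Detects E} d

end EAEncoder

/-- An entanglement-assisted quantum code with parameters `[[n, k, d; c]]_q` exists. -/
def ExistsEAQEC (q n k d c : ℕ) : Prop :=
  ∃ 𝒬 : EAEncoder q n k c, 𝒬.HasMinDistance d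

end Quantum

end EAQ

/-!
A word belongs to the constacyclic code `C` if and only if its polynomial vanishes at the
`2 J + 2` points `δ ^ (s + r t)`, `-J ≤ t ≤ J + 1`, because `q ^ 2`-th powers exchange `t` and
`1 - t`. These points are consecutive in a geometric progression, so that the BCH and the Singleton
bound together give the minimum distance `2 J + 3`. The Hermitian dual is again a code given by
roots, namely by those `ρ` for which `ρ ^ (-q)` is not a root of `C`. A root of `C` which is not a
root of the dual corresponds to a pair `(t, t')` with `q t + t'` in a fixed class modulo `n`, and
estimates leave only four such `t`. Hence the intersection of `C` with its dual has codimension `4`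
in the dual, and this codimension is the rank of `H H*`.

For the quantum code, the trace of a multiple of the Hermitian form is an alternating form over
`𝔽_q`, and the Weyl operators labelled by the words over `𝔽_{q²}` form an error basis that commutes
up to this form. A hyperbolic basis of the dual `W` of `C` has `4` pairs. The Weyl operators of a
maximal isotropic subspace of `W` have a common eigenvector, on which the hyperbolic pairs act as
the operators of `4` qudits at the receiver and a hyperbolic basis of `C` acts as the logical
operators. An error on fewer than `d` qudits is a combination of Weyl operators of weight less than
`d`. The label of each of them is `0` or not in `C`, and in the second case it fails to commute with
an operator of the dual, which the receiver notices.
-/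

namespace EAQ

section Hyperbolic

/-- A family of hyperbolic pairs `(x i, z i)` for a bilinear form. -/
structure IsHyperbolic {ι R V : Type*} [DecidableEq ι] [CommRing R] [AddCommGroup V] [Module R V]
    (B : LinearMap.BilinForm R V) (x z : ι → V) : Prop where
  xx : ∀ i j, B (x i) (x j) = 0
  zz : ∀ i j, B (z i) (z j) = 0
  xz : ∀ i j, B (x i) (z j) = if i = j then 1 else 0

/-- The difference between a vector and its component in the span of a hyperbolic family. -/
def hyperbolicResidue {ι R V : Type*} [Fintype ι] [CommRing R] [AddCommGroup V] [Module R V]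
    (B : LinearMap.BilinForm R V) (x z : ι → V) (w : V) : V :=
  w - (∑ i, B w (z i) • x i + ∑ i, B (x i) w • z i)

/-- A hyperbolic basis of a subspace `W` modulo the radical of the restriction of the form to `W`.
The radical is `W ⊓ B.orthogonal W`. -/
structure IsHyperbolicBasis {ι R V : Type*} [Fintype ι] [DecidableEq ι] [CommRing R]
    [AddCommGroup V] [Module R V] (B : LinearMap.BilinForm R V) (W : Submodule R V)
    (x z : ι → V) : Prop extends IsHyperbolic B x z where
  mem_x : ∀ i, x i ∈ W
  mem_z : ∀ i, z i ∈ W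
  residue_mem_orthogonal : ∀ w ∈ W, hyperbolicResidue B x z w ∈ B.orthogonal W

section CommRing

variable {ι R V : Type*} [CommRing R] [AddCommGroup V] [Module R V]
  {B : LinearMap.BilinForm R V} {W : Submodule R V} {x z : ι → V}

theorem sum_smul_add_sum_smul_mem [Fintype ι] (hx : ∀ i, x i ∈ W) (hz : ∀ i, z i ∈ W)
    (a b : ι → R) :
    ∑ i, a i • x i + ∑ i, b i • z i ∈ W :=
  W.add_mem (W.sum_mem fun i _ => W.smul_mem _ (hx i)) (W.sum_mem fun i _ => W.smul_mem _ (hz i))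

variable [DecidableEq ι]

namespace IsHyperbolic

theorem zx (h : IsHyperbolic B x z) (hB : B.IsAlt) (i j : ι) :
    B (z i) (x j) = if i = j then -1 else 0 := by
  rw [← hB.neg_eq, h.xz]
  split_ifs <;> simp_all

theorem cons {m : ℕ} {x z : Fin m → V} (h : IsHyperbolic B x z) (hB : B.IsAlt) {v w : V}
    (hvw : B v w = 1) (hxv : ∀ i, B (x i) v = 0) (hzv : ∀ i, B (z i) v = 0)
    (hxw : ∀ i, B (x i) w = 0) (hzw : ∀ i, B (z i) w = 0) :
    IsHyperbolic B (Fin.cons v x : Fin (m + 1) → V) (Fin.cons w z) where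
  xx := Fin.cases (Fin.cases (hB v) fun i => hB.isRefl _ _ (hxv i))
    fun i => Fin.cases (hxv i) (h.xx i)
  zz := Fin.cases (Fin.cases (hB w) fun i => hB.isRefl _ _ (hzw i))
    fun i => Fin.cases (hzw i) (h.zz i)
  xz := Fin.cases
    (Fin.cases (by simpa using hvw) fun i => by
      simpa [(Fin.succ_ne_zero i).symm] using hB.isRefl _ _ (hzv i))
    fun i => Fin.cases (by simpa [Fin.succ_ne_zero] using hxw i) fun j => by simpa using h.xz i j

variable [Fintype ι]

theorem apply_x_sum (h : IsHyperbolic B x z) (a b : ι → R) (j : ι) :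
    B (x j) (∑ i, a i • x i + ∑ i, b i • z i) = b j := by
  simp [h.xx, h.xz]

theorem apply_z_sum (h : IsHyperbolic B x z) (hB : B.IsAlt) (a b : ι → R) (j : ι) :
    B (z j) (∑ i, a i • x i + ∑ i, b i • z i) = -a j := by
  simp [h.zz, h.zx hB]

theorem apply_x_residue (h : IsHyperbolic B x z) (w : V) (j : ι) :
    B (x j) (hyperbolicResidue B x z w) = 0 := by
  rw [hyperbolicResidue, map_sub, h.apply_x_sum, sub_self]

theorem apply_z_residue (h : IsHyperbolic B x z) (hB : B.IsAlt) (w : V) (j : ι) :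
    B (z j) (hyperbolicResidue B x z w) = 0 := by
  rw [hyperbolicResidue, map_sub, h.apply_z_sum hB, hB.neg_eq, sub_self]

theorem residue_apply_residue (h : IsHyperbolic B x z) (hB : B.IsAlt) (v w : V) :
    B (hyperbolicResidue B x z v) (hyperbolicResidue B x z w) =
      B v (hyperbolicResidue B x z w) := by
  nth_rw 1 [hyperbolicResidue]
  simp [h.apply_x_residue, h.apply_z_residue hB]

omit [Fintype ι] in
theorem linearIndependent_x [Finite ι] (h : IsHyperbolic B x z) (hB : B.IsAlt) :
    LinearIndependent R x := by
  have := Fintype.ofFinite ι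
  refine Fintype.linearIndependent_iff.2 fun a ha j => ?_
  have hj := h.apply_z_sum hB a 0 j
  simpa [ha] using hj.symm

end IsHyperbolic

namespace IsHyperbolicBasis

variable [Fintype ι]

theorem mem_orthogonal_iff (h : IsHyperbolicBasis B W x z) (hB : B.IsAlt) {w : V} (hw : w ∈ W) :
    w ∈ B.orthogonal W ↔ (∀ i, B (x i) w = 0) ∧ ∀ i, B (z i) w = 0 := by
  refine ⟨fun hwW => ⟨fun i => hwW _ (h.mem_x i), fun i => hwW _ (h.mem_z i)⟩, ?_⟩
  rintro ⟨hx, hz⟩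
  have hres : hyperbolicResidue B x z w = w := by
    simp [hyperbolicResidue, hx, fun i => hB.isRefl _ _ (hz i)]
  exact hres ▸ h.residue_mem_orthogonal w hw

theorem eq_sum (h : IsHyperbolicBasis B ⊤ x z) (hnd : B.Nondegenerate) (w : V) :
    w = ∑ i, B w (z i) • x i + ∑ i, B (x i) w • z i := by
  have hres := h.residue_mem_orthogonal w Submodule.mem_top
  rw [LinearMap.BilinForm.orthogonal_top_eq_bot hnd] at hres
  exact sub_eq_zero.1 ((Submodule.mem_bot R).1 hres)

end IsHyperbolicBasis

end CommRing

section Field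

variable {k V : Type*} [Field k] [AddCommGroup V] [Module k V] [FiniteDimensional k V]
  {B : LinearMap.BilinForm k V} (W : Submodule k V)

theorem IsHyperbolicBasis.finrank_eq {ι : Type*} [Fintype ι] [DecidableEq ι] {x z : ι → V}
    {W : Submodule k V} (h : IsHyperbolicBasis B W x z) (hB : B.IsAlt) :
    Module.finrank k W =
      Module.finrank k (W ⊓ B.orthogonal W : Submodule k V) + 2 * Fintype.card ι := by
  let f : V →ₗ[k] (ι → k) × (ι → k) :=
    (LinearMap.pi fun i => B (x i)).prod (LinearMap.pi fun i => B (z i))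
  have hrange : LinearMap.range (f.domRestrict W) = ⊤ := by
    refine LinearMap.range_eq_top.2 fun y => ?_
    refine ⟨⟨_, sum_smul_add_sum_smul_mem h.mem_x h.mem_z (-y.2) y.1⟩, Prod.ext ?_ ?_⟩
    · exact funext fun j => h.apply_x_sum _ _ j
    · exact funext fun j => (h.apply_z_sum hB _ _ j).trans (neg_neg _)
  have hker : (LinearMap.ker (f.domRestrict W)).map W.subtype = W ⊓ B.orthogonal W := by
    rw [LinearMap.ker_domRestrict, Submodule.map_comap_subtype]
    ext w
    refine and_congr_right fun hw => ?_
    rw [SetLike.mem_coe, SetLike.mem_coe, h.mem_orthogonal_iff hB hw]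
    simp [f, funext_iff]
  have hrank := LinearMap.finrank_range_add_finrank_ker (f.domRestrict W)
  rw [hrange, finrank_top, Module.finrank_prod, Module.finrank_fintype_fun_eq_card] at hrank
  rw [← hker, Submodule.finrank_map_subtype_eq]
  omega

theorem exists_isHyperbolicBasis (hB : B.IsAlt) :
    ∃ m, ∃ x z : Fin m → V, IsHyperbolicBasis B W x z := by
  classical
  let S : ℕ → Prop := fun m => ∃ x z : Fin m → V,
    IsHyperbolic B x z ∧ (∀ i, x i ∈ W) ∧ ∀ i, z i ∈ W
  have hbound : ∀ m, S m → m ≤ Module.finrank k V := by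
    rintro m ⟨x, z, h, -⟩
    simpa using (h.linearIndependent_x hB).fintype_card_le_finrank
  have hempty : S 0 := ⟨Fin.elim0, Fin.elim0, ⟨nofun, nofun, nofun⟩, nofun, nofun⟩
  obtain ⟨x, z, h, hx, hz⟩ := Nat.findGreatest_spec (Nat.zero_le (Module.finrank k V)) hempty
  have hmax : ∀ m, S m → m ≤ Nat.findGreatest S (Module.finrank k V) :=
    fun m hm => Nat.le_findGreatest (hbound m hm) hm
  refine ⟨_, x, z, h, hx, hz, fun w hw v hv => ?_⟩
  by_contra hvw
  have hres : ∀ {u}, u ∈ W → hyperbolicResidue B x z u ∈ W :=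
    fun hu => W.sub_mem hu (sum_smul_add_sum_smul_mem hx hz _ _)
  refine absurd (hmax _ ⟨Fin.cons ((B v (hyperbolicResidue B x z w))⁻¹ • hyperbolicResidue B x z v)
    x, Fin.cons (hyperbolicResidue B x z w) z, h.cons hB ?_ ?_ ?_ ?_ ?_, ?_, ?_⟩)
    (Nat.not_succ_le_self _)
  · rw [map_smul, LinearMap.smul_apply, h.residue_apply_residue hB, smul_eq_mul,
      inv_mul_cancel₀ hvw]
  · exact fun i => by rw [map_smul, h.apply_x_residue, smul_zero]
  · exact fun i => by rw [map_smul, h.apply_z_residue hB, smul_zero]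
  · exact h.apply_x_residue w
  · exact h.apply_z_residue hB w
  · exact Fin.cases (W.smul_mem _ (hres hv)) hx
  · exact Fin.cases (hres hw) hz

end Field

end Hyperbolic

section ErrorBasis

open Matrix

/-- An error basis for an alternating form `ω`: a projective representation of the additive group of
`V` by unitary matrices which commute up to the phases `ψ (ω u v)`, and whose traces vanish away
from `0`. -/
structure IsErrorBasis {k V I : Type*} [CommRing k] [AddCommGroup V] [Module k V] [Fintype I]
    [DecidableEq I] (ψ : AddChar k ℂ) (ω : LinearMap.BilinForm k V) (P : V → Matrix I I ℂ) :
    Prop where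
  zero : P 0 = 1
  mul : ∀ u v, ∃ c : ℂ, c ≠ 0 ∧ P u * P v = c • P (u + v)
  unitary : ∀ u, (P u)ᴴ * P u = 1
  comm : ∀ u v, P u * P v = ψ (ω u v) • (P v * P u)
  trace : ∀ u, u ≠ 0 → (P u).trace = 0

section Form

variable {k V : Type*} [CommRing k] [AddCommGroup V] [Module k V]

/-- The orthogonal sum of copies of a bilinear form. -/
def piForm (ι : Type*) [Fintype ι] (ω : LinearMap.BilinForm k V) :
    LinearMap.BilinForm k (ι → V) :=
  ∑ i, ω.compl₁₂ (LinearMap.proj i) (LinearMap.proj i)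

theorem piForm_apply {ι : Type*} [Fintype ι] (ω : LinearMap.BilinForm k V) (u v : ι → V) :
    piForm ι ω u v = ∑ i, ω (u i) (v i) := by
  simp [piForm, LinearMap.sum_apply]

theorem piForm_isAlt {ι : Type*} [Fintype ι] {ω : LinearMap.BilinForm k V} (h : ω.IsAlt) :
    (piForm ι ω).IsAlt := fun u =>
  (piForm_apply ω u u).trans (Finset.sum_eq_zero fun i _ => h (u i))

/-- The symplectic form of the hyperbolic plane `k × k`. -/
def symplecticForm (k : Type*) [CommRing k] : LinearMap.BilinForm k (k × k) :=
  (LinearMap.mul k k).compl₁₂ (LinearMap.snd k k k) (LinearMap.fst k k k) -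
    (LinearMap.mul k k).compl₁₂ (LinearMap.fst k k k) (LinearMap.snd k k k)

theorem symplecticForm_apply (u v : k × k) :
    symplecticForm k u v = u.2 * v.1 - u.1 * v.2 := rfl

theorem exists_linearEquiv_symplecticForm {k V : Type*} [Field k] [AddCommGroup V] [Module k V]
    {ω : LinearMap.BilinForm k V} (hω : ω.IsAlt) (hnd : ω.Nondegenerate)
    (hV : Module.finrank k V = 2) :
    ∃ φ : V ≃ₗ[k] k × k, ∀ u v, symplecticForm k (φ u) (φ v) = ω u v := by
  have : FiniteDimensional k V := FiniteDimensional.of_finrank_pos (by omega)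
  obtain ⟨m, x, z, h⟩ := exists_isHyperbolicBasis ⊤ hω
  obtain rfl : m = 1 := by
    have hm := h.finrank_eq hω
    rw [LinearMap.BilinForm.orthogonal_top_eq_bot hnd, inf_bot_eq, finrank_bot, finrank_top, hV,
      Fintype.card_fin] at hm
    omega
  have hexpand : ∀ w, w = ω w (z 0) • x 0 + ω (x 0) w • z 0 := fun w => by
    simpa using h.eq_sum hnd w
  let φ : V →ₗ[k] k × k := (ω (x 0)).prod (ω.flip (z 0))
  have hφ : ∀ w, φ w = (ω (x 0) w, ω w (z 0)) := fun w => rfl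
  have hinj : Function.Injective φ := by
    refine (injective_iff_map_eq_zero φ).2 fun w hw => ?_
    have h1 : ω (x 0) w = 0 := congrArg Prod.fst hw
    have h2 : ω w (z 0) = 0 := congrArg Prod.snd hw
    rw [hexpand w, h1, h2, zero_smul, zero_smul, add_zero]
  refine ⟨LinearEquiv.ofInjectiveOfFinrankEq φ hinj (by simp [hV]), fun u v => ?_⟩
  change symplecticForm k (φ u) (φ v) = ω u v
  conv_rhs => rw [hexpand u]
  rw [hφ, hφ, symplecticForm_apply, map_add, map_smul, map_smul, LinearMap.add_apply,
    LinearMap.smul_apply, LinearMap.smul_apply, smul_eq_mul, smul_eq_mul, ← hω.neg_eq v (z 0)]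
  ring

end Form

section Weyl

variable {k A ι : Type*} [CommRing k] [Fintype ι] [DecidableEq A] (ε : A ≃ k) (ψ : AddChar k ℂ)

/-- The Weyl matrices of a family of qudits whose states are labelled by `A ≃ k`: the first
coordinates of `u` shift the labels, the second ones are frequencies of phases. -/
def weyl (u : ι → k × k) : Matrix (ι → A) (ι → A) ℂ :=
  Matrix.of fun x y =>
    if x = fun i => ε.symm (ε (y i) + (u i).1) then ψ (∑ i, (u i).2 * ε (y i)) else 0

theorem weyl_apply (u : ι → k × k) (x y : ι → A) : weyl ε ψ u x y =
    if x = fun i => ε.symm (ε (y i) + (u i).1) then ψ (∑ i, (u i).2 * ε (y i)) else 0 := rfl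

theorem weyl_zero : weyl ε ψ (0 : ι → k × k) = 1 := by
  ext x y
  simp [weyl_apply, Matrix.one_apply]

variable [Fintype A] [DecidableEq ι]

theorem weyl_mul_weyl (u v : ι → k × k) :
    weyl ε ψ u * weyl ε ψ v = ψ (∑ i, (u i).2 * (v i).1) • weyl ε ψ (u + v) := by
  ext x y
  simp only [mul_apply, weyl_apply, mul_ite, mul_zero, Finset.sum_ite_eq', Finset.mem_univ,
    if_true, Equiv.apply_symm_apply, Matrix.smul_apply, smul_eq_mul, ite_mul, zero_mul,
    Pi.add_apply, Prod.fst_add, Prod.snd_add]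
  refine if_congr (by simp only [add_assoc, add_comm]) ?_ rfl
  rw [← AddChar.map_add_eq_mul, ← AddChar.map_add_eq_mul, ← Finset.sum_add_distrib,
    ← Finset.sum_add_distrib]
  exact congrArg ψ (Finset.sum_congr rfl fun i _ => by ring)

theorem conjTranspose_weyl_mul_self [Finite k] (u : ι → k × k) :
    (weyl ε ψ u)ᴴ * weyl ε ψ u = 1 := by
  ext x y
  have hshift : ((fun i => ε.symm (ε (y i) + (u i).1)) = fun i => ε.symm (ε (x i) + (u i).1)) ↔
      x = y := by
    simp [funext_iff, eq_comm]
  simp only [mul_apply, weyl_apply, conjTranspose_apply, mul_ite, mul_zero, Finset.sum_ite_eq',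
    Finset.mem_univ, if_true, one_apply, hshift]
  split_ifs with hxy
  · rw [hxy, ← starRingEnd_apply, ← AddChar.map_neg_eq_conj, ← AddChar.map_add_eq_mul,
      neg_add_cancel, AddChar.map_zero_eq_one]
  · rw [star_zero, zero_mul]

theorem trace_weyl [Finite k] (hψ : ψ.IsPrimitive) {u : ι → k × k} (hu : u ≠ 0) :
    (weyl ε ψ u).trace = 0 := by
  have := Fintype.ofFinite k
  by_cases hshift : ∀ i, (u i).1 = 0
  · obtain ⟨i, hi⟩ : ∃ i, (u i).2 ≠ 0 := by
      by_contra! h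
      exact hu (funext fun i => Prod.ext (hshift i) (h i))
    let χ : AddChar (ι → k) ℂ := ψ.compAddMonoidHom (∑ i, (AddMonoidHom.mulLeft (u i).2).comp
      (Pi.evalAddMonoidHom (fun _ => k) i))
    have hχ : ∀ y, χ y = ψ (∑ i, (u i).2 * y i) := fun y => by simp [χ]
    have hχ1 : χ ≠ 1 := fun h => hψ hi <| by
      ext t
      simpa [hχ, Pi.single_apply] using DFunLike.congr_fun h (Pi.single i t)
    rw [← AddChar.sum_eq_zero_of_ne_one hχ1, ← (Equiv.piCongrRight fun _ : ι => ε).sum_comp]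
    simp [trace, weyl_apply, hshift, hχ]
  · refine Finset.sum_eq_zero fun x _ => ?_
    rw [diag_apply, weyl_apply, if_neg]
    intro hx
    exact hshift fun i => by simpa using congrArg ε (congrFun hx i)

theorem isErrorBasis_weyl [Finite k] (hψ : ψ.IsPrimitive) :
    IsErrorBasis ψ (piForm ι (symplecticForm k)) (weyl ε ψ) where
  zero := weyl_zero ε ψ
  mul u v := ⟨_, (ψ.val_isUnit _).ne_zero, weyl_mul_weyl ε ψ u v⟩
  unitary := conjTranspose_weyl_mul_self ε ψ
  comm u v := by
    rw [weyl_mul_weyl, weyl_mul_weyl, smul_smul, ← AddChar.map_add_eq_mul, add_comm v u,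
      piForm_apply, ← Finset.sum_add_distrib]
    congr 2
    refine Finset.sum_congr rfl fun i _ => ?_
    rw [symplecticForm_apply]
    ring
  trace _ := trace_weyl ε ψ hψ

end Weyl

end ErrorBasis

section CommonEigenvector

variable {K V ι : Type*} [Field K] [IsAlgClosed K] [AddCommGroup V] [Module K V]
  [FiniteDimensional K V] [Nontrivial V]

/-- The induction carries a nonzero common eigenspace `W` which is stable under the whole
commutant, so that the next operator can be restricted to it. -/
theorem exists_common_eigenspace (f : ι → Module.End K V) (s : Finset ι)
    (h : ∀ i ∈ s, ∀ j ∈ s, Commute (f i) (f j)) :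
    ∃ W : Submodule K V, W ≠ ⊥ ∧ (∀ i ∈ s, ∃ μ : K, W ≤ (f i).eigenspace μ) ∧
      ∀ g : Module.End K V, (∀ i ∈ s, Commute g (f i)) → ∀ w ∈ W, g w ∈ W := by
  classical
  induction s using Finset.induction_on with
  | empty => exact ⟨⊤, top_ne_bot, by simp, by simp⟩
  | insert a s _ ih =>
    obtain ⟨W, hW, heigen, hstable⟩ := ih fun i hi j hj =>
      h i (Finset.mem_insert_of_mem hi) j (Finset.mem_insert_of_mem hj)
    have ha : ∀ w ∈ W, f a w ∈ W := hstable _ fun i hi =>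
      h a (Finset.mem_insert_self a s) i (Finset.mem_insert_of_mem hi)
    have : Nontrivial W := Submodule.nontrivial_iff_ne_bot.2 hW
    obtain ⟨μ, hμ⟩ := Module.End.exists_eigenvalue ((f a).restrict ha)
    obtain ⟨w, hw⟩ := hμ.exists_hasEigenvector
    refine ⟨W ⊓ (f a).eigenspace μ, ?_, ?_, fun g hg w hw => ?_⟩
    · refine (Submodule.ne_bot_iff _).2 ⟨w, ⟨w.2, ?_⟩, fun hw0 => hw.2 (Subtype.ext hw0)⟩
      exact Module.End.mem_eigenspace_iff.2 (congrArg Subtype.val hw.apply_eq_smul)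
    · refine Finset.forall_mem_insert .. |>.2 ⟨⟨μ, inf_le_right⟩, fun i hi => ?_⟩
      obtain ⟨ν, hν⟩ := heigen i hi
      exact ⟨ν, inf_le_left.trans hν⟩
    · obtain ⟨hga, hgs⟩ := Finset.forall_mem_insert .. |>.1 hg
      refine ⟨hstable g hgs w hw.1, ?_⟩
      exact Module.End.mapsTo_genEigenspace_of_comm hga.symm μ 1 hw.2

theorem exists_common_eigenvector (f : ι → Module.End K V) (s : Finset ι)
    (h : ∀ i ∈ s, ∀ j ∈ s, Commute (f i) (f j)) :
    ∃ v : V, v ≠ 0 ∧ ∀ i ∈ s, ∃ μ : K, f i v = μ • v := by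
  obtain ⟨W, hW, heigen, -⟩ := exists_common_eigenspace f s h
  obtain ⟨v, hv, hv0⟩ := Submodule.exists_mem_ne_zero_of_ne_bot hW
  refine ⟨v, hv0, fun i hi => ?_⟩
  obtain ⟨μ, hμ⟩ := heigen i hi
  exact ⟨μ, Module.End.mem_eigenspace_iff.1 (hμ hv)⟩

end CommonEigenvector

section ErrorBasis

open Matrix

namespace IsErrorBasis

variable {k V I : Type*} [CommRing k] [AddCommGroup V] [Module k V] [Fintype I] [DecidableEq I]
  {ψ : AddChar k ℂ} {ω : LinearMap.BilinForm k V} {P : V → Matrix I I ℂ}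

theorem comp (h : IsErrorBasis ψ ω P) {V' : Type*} [AddCommGroup V'] [Module k V']
    {ω' : LinearMap.BilinForm k V'} {f : V' →ₗ[k] V} (hf : Function.Injective f)
    (hω : ∀ u v, ω (f u) (f v) = ω' u v) : IsErrorBasis ψ ω' fun u => P (f u) where
  zero := by rw [map_zero, h.zero]
  mul u v := by simpa only [map_add] using h.mul (f u) (f v)
  unitary u := h.unitary (f u)
  comm u v := hω u v ▸ h.comm (f u) (f v)
  trace u hu := h.trace (f u) ((map_ne_zero_iff f hf).2 hu)

theorem conjTranspose_eq_smul (h : IsErrorBasis ψ ω P) (u : V) :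
    ∃ c : ℂ, (P u)ᴴ = c • P (-u) := by
  obtain ⟨c, hc, hmul⟩ := h.mul (-u) u
  have hinv : P (-u) = c • (P u)ᴴ := by
    rw [← Matrix.mul_one (P (-u)), ← mul_eq_one_comm.1 (h.unitary u), ← Matrix.mul_assoc, hmul,
      neg_add_cancel, h.zero, Matrix.smul_mul, Matrix.one_mul]
  exact ⟨c⁻¹, by rw [hinv, inv_smul_smul₀ hc]⟩

theorem trace_conjTranspose_mul (h : IsErrorBasis ψ ω P) {u v : V} (huv : u ≠ v) :
    ((P u)ᴴ * P v).trace = 0 := by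
  obtain ⟨c, hc⟩ := h.conjTranspose_eq_smul u
  obtain ⟨d, -, hd⟩ := h.mul (-u) v
  rw [hc, Matrix.smul_mul, hd, trace_smul, trace_smul,
    h.trace _ fun h0 => huv (neg_add_eq_zero.1 h0), smul_zero, smul_zero]

theorem linearIndependent [Nonempty I] (h : IsErrorBasis ψ ω P) : LinearIndependent ℂ P := by
  refine linearIndependent_iff'.2 fun s a ha u hu => ?_
  have htrace := congrArg (fun M => ((P u)ᴴ * M).trace) ha
  rw [Finset.mul_sum, trace_sum, Finset.sum_eq_single_of_mem u hu] at htrace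
  · simpa [h.unitary, trace_one] using htrace
  · intro v _ hvu
    rw [Matrix.mul_smul, trace_smul, h.trace_conjTranspose_mul hvu.symm, smul_zero]

theorem span_range_eq_top [Nonempty I] [Fintype V] (h : IsErrorBasis ψ ω P)
    (hcard : Fintype.card V = Fintype.card I ^ 2) : Submodule.span ℂ (Set.range P) = ⊤ :=
  h.linearIndependent.span_eq_top_of_card_eq_finrank' <| by
    rw [hcard, Module.finrank_matrix, Module.finrank_self, mul_one, sq]

end IsErrorBasis

section Local

variable {k ι A : Type*} [CommRing k] [Fintype ι] [DecidableEq ι] [DecidableEq A]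

/-- The operator `M ⊗ 1`, for an operator `M` on the qudits in `T`. -/
def localOperator (T : Finset ι) :
    Matrix (T → A) (T → A) ℂ →ₗ[ℂ] Matrix (ι → A) (ι → A) ℂ where
  toFun M := Matrix.of fun x y =>
    if ∀ i ∉ T, x i = y i then M (fun i => x i) (fun i => y i) else 0
  map_add' M N := by
    ext x y
    simp only [of_apply, Matrix.add_apply, ← ite_add_zero]
  map_smul' c M := by
    ext x y
    simp only [of_apply, Matrix.smul_apply, smul_ite, smul_zero, RingHom.id_apply]

theorem localOperator_apply (T : Finset ι) (M : Matrix (T → A) (T → A) ℂ) (x y : ι → A) :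
    localOperator T M x y =
      if ∀ i ∉ T, x i = y i then M (fun i => x i) (fun i => y i) else 0 := rfl

theorem localOperator_weyl (ε : A ≃ k) (ψ : AddChar k ℂ) {T : Finset ι} {u : ι → k × k}
    (hu : ∀ i ∉ T, u i = 0) : localOperator T (weyl ε ψ fun i : T => u i) = weyl ε ψ u := by
  ext x y
  have hsum : ∑ i, (u i).2 * ε (y i) = ∑ i : T, (u i).2 * ε (y i) := by
    rw [Finset.sum_coe_sort T fun i => (u i).2 * ε (y i)]
    exact (Finset.sum_subset T.subset_univ fun i _ hi => by simp [hu i hi]).symm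
  have hshift : (x = fun i => ε.symm (ε (y i) + (u i).1)) ↔ (∀ i ∉ T, x i = y i) ∧
      (fun i : T => x i) = fun i : T => ε.symm (ε (y i) + (u i).1) := by
    simp only [funext_iff, Subtype.forall]
    refine ⟨fun h => ⟨fun i hi => by simp [h i, hu i hi], fun i _ => h i⟩, fun h i => ?_⟩
    by_cases hi : i ∈ T
    · exact h.2 i hi
    · simp [h.1 i hi, hu i hi]
  simp only [localOperator_apply, weyl_apply, hsum, hshift, ite_and]

end Local

section Qudit

variable {k G : Type*} [CommRing k] [AddCommGroup G] [Module k G] {q n : ℕ}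

theorem actsOn_iff {T : Finset (Fin n)} {E : Matrix (Fin n → Fin q) (Fin n → Fin q) ℂ} :
    EAEncoder.ActsOn T E ↔ ∃ M, localOperator T M = E := by
  refine exists_congr fun M => ⟨fun h => ?_, ?_⟩
  · ext x y
    rw [localOperator_apply]
    split_ifs with hxy
    exacts [((h x y).1 hxy).symm, ((h x y).2 hxy).symm]
  · rintro rfl x y
    exact ⟨fun hxy => if_pos hxy, fun hxy => if_neg hxy⟩

/-- An error basis of `n` qudits which is compatible with the locality of errors: each qudit carries
a copy of the form `ω`, and the basis elements which are supported in a set `T` of qudits span the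
operators on `T`. -/
structure IsQuditErrorBasis (ψ : AddChar k ℂ) (ω : LinearMap.BilinForm k G)
    (P : (Fin n → G) → Matrix (Fin n → Fin q) (Fin n → Fin q) ℂ) : Prop
    extends IsErrorBasis ψ (piForm (Fin n) ω) P where
  actsOn : ∀ {T : Finset (Fin n)} {u}, (∀ i ∉ T, u i = 0) → EAEncoder.ActsOn T (P u)
  mem_span : ∀ {T : Finset (Fin n)} {E}, EAEncoder.ActsOn T E →
    E ∈ Submodule.span ℂ (P '' {u | ∀ i ∉ T, u i = 0})

theorem isQuditErrorBasis_weyl [Finite k] (ε : Fin q ≃ k) {ψ : AddChar k ℂ}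
    (hψ : ψ.IsPrimitive) :
    IsQuditErrorBasis (n := n) ψ (symplecticForm k) (weyl ε ψ) where
  toIsErrorBasis := isErrorBasis_weyl ε ψ hψ
  actsOn hu := actsOn_iff.2 ⟨_, localOperator_weyl ε ψ hu⟩
  mem_span {T E} hE := by
    obtain ⟨M, rfl⟩ := actsOn_iff.1 hE
    have := Fintype.ofEquiv _ ε
    have : Nonempty (Fin q) := ⟨ε.symm 0⟩
    have hspan := (isErrorBasis_weyl (ι := T) ε ψ hψ).span_range_eq_top (by
      simp [← Fintype.card_congr ε, ← sq, ← pow_mul, mul_comm])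
    have hM := Submodule.mem_map_of_mem (f := localOperator T)
      (hspan ▸ Submodule.mem_top : M ∈ Submodule.span ℂ (Set.range (weyl ε ψ)))
    rw [Submodule.map_span] at hM
    refine Submodule.span_mono ?_ hM
    rintro _ ⟨_, ⟨w, rfl⟩, rfl⟩
    obtain ⟨u, hu, rfl⟩ : ∃ u : Fin n → k × k, (∀ i ∉ T, u i = 0) ∧ (fun i : T => u i) = w :=
      ⟨fun i => if h : i ∈ T then w ⟨i, h⟩ else 0, fun i hi => dif_neg hi,
        funext fun i => dif_pos i.2⟩
    exact ⟨u, hu, (localOperator_weyl ε ψ hu).symm⟩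

theorem IsQuditErrorBasis.comp {G' : Type*} [AddCommGroup G'] [Module k G'] {ψ : AddChar k ℂ}
    {ω : LinearMap.BilinForm k G} {ω' : LinearMap.BilinForm k G'}
    {P : (Fin n → G) → Matrix (Fin n → Fin q) (Fin n → Fin q) ℂ} (h : IsQuditErrorBasis ψ ω P)
    (φ : G' ≃ₗ[k] G) (hφ : ∀ u v, ω (φ u) (φ v) = ω' u v) :
    IsQuditErrorBasis ψ ω' fun u => P fun i => φ (u i) where
  toIsErrorBasis := h.toIsErrorBasis.comp
    (f := (LinearEquiv.piCongrRight fun _ : Fin n => φ).toLinearMap)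
    (LinearEquiv.injective _) fun u v => by simp [piForm_apply, hφ]
  actsOn hu := h.actsOn fun i hi => by rw [hu i hi, map_zero]
  mem_span hE := by
    refine Submodule.span_mono ?_ (h.mem_span hE)
    rintro _ ⟨u, hu, rfl⟩
    exact ⟨fun i => φ.symm (u i), fun i hi => by simp [hu i hi], by simp⟩

theorem exists_isQuditErrorBasis {k : Type*} [Field k] [Module k G] [Finite k] (ε : Fin q ≃ k)
    {ψ : AddChar k ℂ} (hψ : ψ.IsPrimitive) {ω : LinearMap.BilinForm k G} (hω : ω.IsAlt)
    (hnd : ω.Nondegenerate) (hG : Module.finrank k G = 2) :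
    ∃ P : (Fin n → G) → Matrix (Fin n → Fin q) (Fin n → Fin q) ℂ, IsQuditErrorBasis ψ ω P := by
  obtain ⟨φ, hφ⟩ := exists_linearEquiv_symplecticForm hω hnd hG
  exact ⟨_, (isQuditErrorBasis_weyl ε hψ).comp φ hφ⟩

end Qudit

end ErrorBasis

section LogicalBasis

open Matrix

/-- An orthonormal family `Φ m b` of vectors for which the operators in `𝒞` act monomially on the
first index (the message) and those in `𝒟` act monomially on the second index (the receiver's halves
of the pairs). -/
structure IsLogicalBasis {I M B : Type*} [Fintype I] [DecidableEq M] [DecidableEq B]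
    (𝒞 𝒟 : Set (Matrix I I ℂ)) (Φ : M → B → I → ℂ) : Prop where
  orthonormal : ∀ m b m' b', star (Φ m b) ⬝ᵥ Φ m' b' = if m = m' ∧ b = b' then 1 else 0
  left : ∀ E ∈ 𝒞, ∃ (σ : M → M) (γ : M → ℂ), ∀ m b, E *ᵥ Φ m b = γ m • Φ (σ m) b
  right : ∀ E ∈ 𝒟, ∃ (σ : Equiv.Perm B) (γ : B → ℂ), ∀ m b, E *ᵥ Φ m b = γ b • Φ m (σ b)

section Unitary

variable {I : Type*} [Fintype I] [DecidableEq I] {A : Matrix I I ℂ}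

theorem star_mulVec_dotProduct_mulVec (hA : Aᴴ * A = 1) (x y : I → ℂ) :
    star (A *ᵥ x) ⬝ᵥ A *ᵥ y = star x ⬝ᵥ y := by
  rw [star_mulVec, dotProduct_mulVec, vecMul_vecMul, hA, vecMul_one]

theorem star_mul_self_of_mulVec_eq_smul (hA : Aᴴ * A = 1) {x y : I → ℂ} {a : ℂ}
    (hx : star x ⬝ᵥ x = 1) (hy : star y ⬝ᵥ y = 1) (h : A *ᵥ x = a • y) : star a * a = 1 := by
  have hnorm := star_mulVec_dotProduct_mulVec hA x x
  rwa [h, hx, star_smul, smul_dotProduct, dotProduct_smul, hy, smul_eq_mul, smul_eq_mul,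
    mul_one] at hnorm

theorem star_dotProduct_eq_zero_of_eigenvalue_ne (hA : Aᴴ * A = 1) {x y : I → ℂ} {a b : ℂ}
    (ha : star a * a = 1) (hx : A *ᵥ x = a • x) (hy : A *ᵥ y = b • y) (hab : a ≠ b) :
    star x ⬝ᵥ y = 0 := by
  have h := star_mulVec_dotProduct_mulVec hA x y
  rw [hx, hy, star_smul, smul_dotProduct, dotProduct_smul, smul_smul, smul_eq_mul] at h
  by_contra hxy
  refine hab (mul_left_cancel₀ (left_ne_zero_of_mul_eq_one ha) ?_)
  rw [ha, mul_right_cancel₀ hxy (h.trans (one_mul _).symm)]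

end Unitary

namespace IsLogicalBasis

variable {I M B : Type*} [Fintype I] [DecidableEq M] [DecidableEq B]
  {𝒞 𝒟 : Set (Matrix I I ℂ)} {Φ : M → B → I → ℂ}

theorem reindex {M' B' : Type*} [DecidableEq M'] [DecidableEq B'] (h : IsLogicalBasis 𝒞 𝒟 Φ)
    (e : M' ≃ M) (f : B' ≃ B) : IsLogicalBasis 𝒞 𝒟 fun m b => Φ (e m) (f b) where
  orthonormal m b m' b' := by simp [h.orthonormal]
  left E hE := by
    obtain ⟨σ, γ, hσ⟩ := h.left E hE
    exact ⟨fun m => e.symm (σ (e m)), fun m => γ (e m), fun m b => by simp [hσ]⟩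
  right E hE := by
    obtain ⟨σ, γ, hσ⟩ := h.right E hE
    exact ⟨(f.trans σ).trans f.symm, fun b => γ (f b), fun m b => by simp [hσ]⟩

theorem dotProduct_self (h : IsLogicalBasis 𝒞 𝒟 Φ) (m : M) (b : B) :
    star (Φ m b) ⬝ᵥ Φ m b = 1 := by
  simp [h.orthonormal]

variable [Fintype B] [DecidableEq I] {k V : Type*} [CommRing k] [AddCommGroup V] [Module k V]
  {ψ : AddChar k ℂ} {ω : LinearMap.BilinForm k V} {P : V → Matrix I I ℂ}

theorem sum_dotProduct_eq_zero (h : IsLogicalBasis 𝒞 𝒟 Φ) (hP : IsErrorBasis ψ ω P) {u w : V}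
    (hw : P w ∈ 𝒟) (hwu : ψ (ω w u) ≠ 1) (m m' : M) :
    ∑ b, star (Φ m b) ⬝ᵥ P u *ᵥ Φ m' b = 0 := by
  obtain ⟨σ, γ, hσ⟩ := h.right _ hw
  have hterm : ∀ b, star (Φ m b) ⬝ᵥ P u *ᵥ Φ m' b =
      ψ (ω w u) * (star (Φ m (σ b)) ⬝ᵥ P u *ᵥ Φ m' (σ b)) := fun b => by
    have hγ := star_mul_self_of_mulVec_eq_smul (hP.unitary w) (h.dotProduct_self m b)
      (h.dotProduct_self m (σ b)) (hσ m b)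
    calc star (Φ m b) ⬝ᵥ P u *ᵥ Φ m' b
        = star (P w *ᵥ Φ m b) ⬝ᵥ ψ (ω w u) • P u *ᵥ P w *ᵥ Φ m' b := by
          rw [← star_mulVec_dotProduct_mulVec (hP.unitary w), mulVec_mulVec, hP.comm,
            smul_mulVec, ← mulVec_mulVec]
      _ = (star (γ b) * γ b) * (ψ (ω w u) * (star (Φ m (σ b)) ⬝ᵥ P u *ᵥ Φ m' (σ b))) := by
          simp only [hσ, mulVec_smul, star_smul, smul_dotProduct, dotProduct_smul, smul_eq_mul]
          ring
      _ = _ := by rw [hγ, one_mul]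
  have hsum : ∑ b, star (Φ m b) ⬝ᵥ P u *ᵥ Φ m' b =
      ψ (ω w u) * ∑ b, star (Φ m b) ⬝ᵥ P u *ᵥ Φ m' b := by
    exact (Finset.sum_congr rfl fun b _ => hterm b).trans <| by
      rw [← Finset.mul_sum, Equiv.sum_comp σ fun b => star (Φ m b) ⬝ᵥ P u *ᵥ Φ m' b]
  by_contra hS
  exact hwu (mul_right_cancel₀ hS (by rw [← hsum, one_mul]))

theorem exists_mulVec_eq_smul [Nonempty B] (h : IsLogicalBasis 𝒞 𝒟 Φ) {A : Matrix I I ℂ}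
    (hA : Aᴴ * A = 1) (hA𝒞 : A ∈ 𝒞) {ζ : ℂ}
    (hζ : ∀ m m', ∑ b, star (Φ m b) ⬝ᵥ A *ᵥ Φ m' b = if m = m' then ζ else 0) :
    ∃ a : ℂ, ∀ m b, A *ᵥ Φ m b = a • Φ m b := by
  obtain ⟨σ, γ, hσ⟩ := h.left _ hA𝒞
  refine ⟨(Fintype.card B : ℂ)⁻¹ * ζ, fun m b => ?_⟩
  have hcard : (Fintype.card B : ℂ) ≠ 0 := Nat.cast_ne_zero.2 Fintype.card_ne_zero
  have hγ : γ m ≠ 0 := right_ne_zero_of_mul_eq_one <| star_mul_self_of_mulVec_eq_smul hA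
    (h.dotProduct_self m b) (h.dotProduct_self (σ m) b) (hσ m b)
  have hm := hζ (σ m) m
  simp only [hσ, dotProduct_smul, h.dotProduct_self, smul_eq_mul, mul_one, Finset.sum_const,
    Finset.card_univ, nsmul_eq_mul] at hm
  split_ifs at hm with hσm
  · rw [hσ, hσm, ← hm, inv_mul_cancel_left₀ hcard]
  · exact absurd hm (mul_ne_zero hcard hγ)

theorem sum_dotProduct_ne_scalar [Nonempty M] [Nonempty B] (h : IsLogicalBasis 𝒞 𝒟 Φ)
    (hP : IsErrorBasis ψ ω P) {u w : V} (hu : P u ∈ 𝒞) (hw : P w ∈ 𝒞) (hwu : ψ (ω w u) ≠ 1)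
    (ζ : ℂ) : ¬ ∀ m m', ∑ b, star (Φ m b) ⬝ᵥ P u *ᵥ Φ m' b = if m = m' then ζ else 0 := by
  intro hζ
  obtain ⟨a, ha⟩ := h.exists_mulVec_eq_smul (hP.unitary u) hu hζ
  obtain ⟨τ, ρ, hτ⟩ := h.left _ hw
  obtain ⟨m⟩ := ‹Nonempty M›
  obtain ⟨b⟩ := ‹Nonempty B›
  have ha1 := star_mul_self_of_mulVec_eq_smul (hP.unitary u) (h.dotProduct_self m b)
    (h.dotProduct_self m b) (ha m b)
  have hρ1 := star_mul_self_of_mulVec_eq_smul (hP.unitary w) (h.dotProduct_self m b)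
    (h.dotProduct_self (τ m) b) (hτ m b)
  have hcomm : (a * ρ m) • Φ (τ m) b = (ψ (ω w u) * (a * ρ m)) • Φ (τ m) b := by
    calc (a * ρ m) • Φ (τ m) b = (P w * P u) *ᵥ Φ m b := by
          rw [← mulVec_mulVec, ha, mulVec_smul, hτ, smul_smul]
      _ = ψ (ω w u) • P u *ᵥ P w *ᵥ Φ m b := by rw [hP.comm, smul_mulVec, mulVec_mulVec]
      _ = _ := by rw [hτ, mulVec_smul, ha, smul_smul, smul_smul, mul_assoc, mul_comm (ρ m)]
  have hΦ : Φ (τ m) b ≠ 0 := fun h0 => by simpa [h0] using h.dotProduct_self (τ m) b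
  refine hwu (mul_right_cancel₀ (b := a * ρ m) ?_ ?_)
  · exact mul_ne_zero (right_ne_zero_of_mul_eq_one ha1) (right_ne_zero_of_mul_eq_one hρ1)
  · exact (smul_left_injective ℂ hΦ hcomm).symm.trans (one_mul _).symm

end IsLogicalBasis

end LogicalBasis

section LogicalBasisConstruction

open Matrix

variable {ι k V : Type*} [CommRing k] [AddCommGroup V] [Module k V]

/-- The part of `W` orthogonal to the second halves `z` of a hyperbolic basis of `W`, a maximal
isotropic subspace of `W`. -/
def isotropicPart (ω : LinearMap.BilinForm k V) (W : Submodule k V) (z : ι → V) : Submodule k V :=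
  W ⊓ ⨅ i, LinearMap.ker (ω (z i))

theorem mem_isotropicPart {ω : LinearMap.BilinForm k V} {W : Submodule k V} {z : ι → V} {v : V} :
    v ∈ isotropicPart ω W z ↔ v ∈ W ∧ ∀ i, ω (z i) v = 0 := by
  simp [isotropicPart]

variable [Fintype ι] [DecidableEq ι] {ω : LinearMap.BilinForm k V} {W : Submodule k V}
  {x z : ι → V}

theorem IsHyperbolicBasis.z_mem_isotropicPart (h : IsHyperbolicBasis ω W x z) (i : ι) :
    z i ∈ isotropicPart ω W z :=
  mem_isotropicPart.2 ⟨h.mem_z i, fun j => h.zz j i⟩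

theorem IsHyperbolicBasis.isotropicPart_le_orthogonal (h : IsHyperbolicBasis ω W x z)
    (hω : ω.IsAlt) : isotropicPart ω W z ≤ ω.orthogonal (isotropicPart ω W z) := by
  intro v hv u hu
  obtain ⟨hvW, hvz⟩ := mem_isotropicPart.1 hv
  obtain ⟨huW, huz⟩ := mem_isotropicPart.1 hu
  have hu_eq : u = hyperbolicResidue ω x z u + ∑ i, ω (x i) u • z i := by
    simp [hyperbolicResidue, fun i => hω.isRefl _ _ (huz i)]
  have hres : ω (hyperbolicResidue ω x z u) v = 0 :=
    hω.isRefl _ _ (h.residue_mem_orthogonal u huW v hvW)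
  rw [hu_eq]
  simp [hres, hvz]

theorem IsHyperbolicBasis.sub_mem_isotropicPart (h : IsHyperbolicBasis ω W x z) (hω : ω.IsAlt)
    {u : V} (hu : u ∈ W) : u - ∑ i, ω u (z i) • x i ∈ isotropicPart ω W z := by
  refine mem_isotropicPart.2
    ⟨W.sub_mem hu (W.sum_mem fun i _ => W.smul_mem _ (h.mem_x i)), fun j => ?_⟩
  simp [h.zx hω, ← hω.neg_eq u (z j)]

theorem sup_le_orthogonal_sup {L₁ L₂ : Submodule k V} {ω : LinearMap.BilinForm k V} (hω : ω.IsAlt)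
    (h₁ : L₁ ≤ ω.orthogonal L₁) (h₂ : L₂ ≤ ω.orthogonal L₂) (h₁₂ : L₁ ≤ ω.orthogonal L₂) :
    L₁ ⊔ L₂ ≤ ω.orthogonal (L₁ ⊔ L₂) := by
  intro v hv u hu
  obtain ⟨v₁, hv₁, v₂, hv₂, rfl⟩ := Submodule.mem_sup.1 hv
  obtain ⟨u₁, hu₁, u₂, hu₂, rfl⟩ := Submodule.mem_sup.1 hu
  have h21 : ω u₁ v₂ = 0 := hω.isRefl _ _ (h₁₂ hu₁ v₂ hv₂)
  rw [map_add, map_add, LinearMap.add_apply, LinearMap.add_apply, h₁ hv₁ u₁ hu₁, h₁₂ hv₁ u₂ hu₂,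
    h21, h₂ hv₂ u₂ hu₂]
  simp only [add_zero]

section Action

variable {I : Type*} [Fintype I] [DecidableEq I] {ψ : AddChar k ℂ} {P : V → Matrix I I ℂ}

theorem IsErrorBasis.mulVec_mulVec_comm (hP : IsErrorBasis ψ ω P) (u v : V) (a : I → ℂ) :
    P u *ᵥ P v *ᵥ a = ψ (ω u v) • P v *ᵥ P u *ᵥ a := by
  rw [mulVec_mulVec, hP.comm, smul_mulVec, mulVec_mulVec]

theorem IsErrorBasis.mulVec_mulVec_of_apply_eq_zero (hP : IsErrorBasis ψ ω P) {y g : V}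
    (hyg : ω y g = 0) {v : I → ℂ} {μ : ℂ} (hμ : P y *ᵥ v = μ • v) :
    P y *ᵥ P g *ᵥ v = μ • P g *ᵥ v := by
  rw [hP.mulVec_mulVec_comm, hyg, AddChar.map_zero_eq_one, one_smul, hμ, mulVec_smul]

theorem IsErrorBasis.exists_mul_eq_smul_mul (hP : IsErrorBasis ψ ω P) {u v u' v' : V}
    (h : u + v = u' + v') : ∃ c : ℂ, P u * P v = c • (P u' * P v') := by
  obtain ⟨c, -, hc⟩ := hP.mul u v
  obtain ⟨d, hd, hd'⟩ := hP.mul u' v'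
  exact ⟨c * d⁻¹, by rw [hc, hd', h, mul_smul, inv_smul_smul₀ hd]⟩

theorem exists_unit_common_eigenvector [Finite V] [Nonempty I] (hP : IsErrorBasis ψ ω P)
    {L : Submodule k V} (hL : L ≤ ω.orthogonal L) :
    ∃ v : I → ℂ, star v ⬝ᵥ v = 1 ∧ ∀ y ∈ L, ∃ μ : ℂ, P y *ᵥ v = μ • v := by
  have := Fintype.ofFinite L
  have hcomm : ∀ y z : L, Commute (P y).mulVecLin (P z).mulVecLin := fun y z => by
    have hyz : ω (y : V) (z : V) = 0 := hL z.2 y y.2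
    rw [commute_iff_eq, Module.End.mul_eq_comp, Module.End.mul_eq_comp, ← mulVecLin_mul,
      ← mulVecLin_mul, hP.comm, hyz, AddChar.map_zero_eq_one, one_smul]
  obtain ⟨v, hv, heigen⟩ := exists_common_eigenvector (fun y : L => (P y).mulVecLin) Finset.univ
    fun y _ z _ => hcomm y z
  have hnorm : (‖WithLp.toLp 2 v‖ : ℂ) ≠ 0 := by simpa using hv
  refine ⟨(‖WithLp.toLp 2 v‖⁻¹ : ℂ) • v, ?_, fun y hy => ?_⟩
  · have hself : star v ⬝ᵥ v = (‖WithLp.toLp 2 v‖ : ℂ) ^ 2 := by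
      rw [dotProduct_comm]
      exact inner_self_eq_norm_sq_to_K (𝕜 := ℂ) (WithLp.toLp 2 v)
    rw [star_smul, smul_dotProduct, dotProduct_smul, hself]
    simp only [star_inv₀, Complex.star_def, Complex.conj_ofReal, smul_eq_mul]
    field_simp
  · obtain ⟨μ, hμ⟩ := heigen ⟨y, hy⟩ (Finset.mem_univ _)
    exact ⟨μ, by rw [mulVec_smul, show P y *ᵥ v = μ • v from hμ, smul_comm]⟩

/-- Write `u` as the sum of its `x`-component and an element `y` of the isotropic part: the former
translates the labels `a`, and `P y` acts on `v` by a scalar. -/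
theorem IsHyperbolicBasis.exists_mulVec_eq_smul (h : IsHyperbolicBasis ω W x z) (hω : ω.IsAlt)
    (hP : IsErrorBasis ψ ω P) {v : I → ℂ}
    (hv : ∀ y ∈ isotropicPart ω W z, ∃ μ : ℂ, P y *ᵥ v = μ • v) {u : V} (hu : u ∈ W) :
    ∃ γ : (ι → k) → ℂ, ∀ a, ∀ g ∈ ω.orthogonal W, P u *ᵥ P (∑ i, a i • x i) *ᵥ P g *ᵥ v =
      γ a • P (∑ i, (a i + ω u (z i)) • x i) *ᵥ P g *ᵥ v := by
  set y := u - ∑ i, ω u (z i) • x i with hy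
  have hyL := h.sub_mem_isotropicPart hω hu
  obtain ⟨μ, hμ⟩ := hv y hyL
  have hsplit : ∀ a : ι → k,
      u + ∑ i, a i • x i = ∑ i, (a i + ω u (z i)) • x i + y := fun a => by
    simp only [hy, add_smul, Finset.sum_add_distrib]
    abel
  choose c hc using fun a => hP.exists_mul_eq_smul_mul (hsplit a)
  refine ⟨fun a => c a * μ, fun a g hg => ?_⟩
  have hyg : ω y g = 0 := hg y (mem_isotropicPart.1 hyL).1
  rw [mulVec_mulVec, hc, smul_mulVec, ← mulVec_mulVec, hP.mulVec_mulVec_of_apply_eq_zero hyg hμ,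
    mulVec_smul, smul_smul]

omit [Fintype I] [DecidableEq I] in
theorem exists_map_mul_ne (hψ : ψ.IsPrimitive) {a b : k} (hab : a ≠ b) :
    ∃ t, ψ (t * a) ≠ ψ (t * b) := by
  by_contra! h
  refine hψ (sub_ne_zero.2 hab) (DFunLike.ext _ _ fun t => ?_)
  rw [AddChar.mulShift_apply, sub_mul, AddChar.map_sub_eq_div, mul_comm a, mul_comm b, h,
    div_self (ψ.val_isUnit _).ne_zero, AddChar.one_apply]

/-- The two vectors are eigenvectors of `P (t • z j)` with different eigenvalues, for a suitable
multiple of `z j` where `a j ≠ a' j`. -/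
theorem IsHyperbolicBasis.star_dotProduct_eq_zero (h : IsHyperbolicBasis ω W x z) (hω : ω.IsAlt)
    (hψ : ψ.IsPrimitive) (hP : IsErrorBasis ψ ω P) {v : I → ℂ} (hv1 : star v ⬝ᵥ v = 1)
    (hv : ∀ y ∈ isotropicPart ω W z, ∃ μ : ℂ, P y *ᵥ v = μ • v) {a a' : ι → k} (haa' : a ≠ a')
    {g g' : V} (hg : g ∈ ω.orthogonal W) (hg' : g' ∈ ω.orthogonal W) :
    star (P (∑ i, a i • x i) *ᵥ P g *ᵥ v) ⬝ᵥ (P (∑ i, a' i • x i) *ᵥ P g' *ᵥ v) = 0 := by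
  obtain ⟨j, hj⟩ := Function.ne_iff.1 haa'
  obtain ⟨t, ht⟩ := exists_map_mul_ne hψ (neg_injective.ne hj)
  have hy := (isotropicPart ω W z).smul_mem t (h.z_mem_isotropicPart j)
  obtain ⟨μ, hμ⟩ := hv _ hy
  have heigen : ∀ (b : ι → k), ∀ g ∈ ω.orthogonal W,
      P (t • z j) *ᵥ P (∑ i, b i • x i) *ᵥ P g *ᵥ v =
        (ψ (t * -b j) * μ) • P (∑ i, b i • x i) *ᵥ P g *ᵥ v := fun b g hg => by
    have hyb : ω (t • z j) (∑ i, b i • x i) = t * -b j := by simp [h.zx hω, mul_comm]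
    rw [hP.mulVec_mulVec_comm, hyb, hP.mulVec_mulVec_of_apply_eq_zero
      (hg _ (mem_isotropicPart.1 hy).1) hμ, mulVec_smul, smul_smul]
  have hself : star (P (∑ i, a i • x i) *ᵥ P g *ᵥ v) ⬝ᵥ (P (∑ i, a i • x i) *ᵥ P g *ᵥ v) = 1 := by
    rw [star_mulVec_dotProduct_mulVec (hP.unitary _),
      star_mulVec_dotProduct_mulVec (hP.unitary _), hv1]
  have hμ1 := star_mul_self_of_mulVec_eq_smul (hP.unitary _) hv1 hv1 hμ
  refine star_dotProduct_eq_zero_of_eigenvalue_ne (hP.unitary _)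
    (star_mul_self_of_mulVec_eq_smul (hP.unitary _) hself hself (heigen a g hg))
    (heigen a g hg) (heigen a' g' hg') fun hphase => ht ?_
  exact mul_right_cancel₀ (right_ne_zero_of_mul_eq_one hμ1) hphase

theorem exists_isLogicalBasis [Finite V] [Nonempty I] (hω : ω.IsAlt) (hψ : ψ.IsPrimitive)
    (hP : IsErrorBasis ψ ω P) {C D : Submodule k V} (hCD : C ≤ ω.orthogonal D)
    {ι' : Type*} [Fintype ι'] [DecidableEq ι'] {x' z' : ι' → V} (h : IsHyperbolicBasis ω D x z)
    (h' : IsHyperbolicBasis ω C x' z') [DecidableEq k] :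
    ∃ Φ : (ι' → k) → (ι → k) → I → ℂ, IsLogicalBasis (P '' C) (P '' D) Φ := by
  have hDC : D ≤ ω.orthogonal C := fun v hv u hu => hω.isRefl _ _ (hCD hu v hv)
  have hL : isotropicPart ω D z ⊔ isotropicPart ω C z' ≤
      ω.orthogonal (isotropicPart ω D z ⊔ isotropicPart ω C z') :=
    sup_le_orthogonal_sup hω (h.isotropicPart_le_orthogonal hω) (h'.isotropicPart_le_orthogonal hω)
      ((inf_le_left.trans hDC).trans (LinearMap.BilinForm.orthogonal_le inf_le_left))
  obtain ⟨v, hv1, hv⟩ := exists_unit_common_eigenvector hP hL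
  have hvD : ∀ y ∈ isotropicPart ω D z, ∃ μ : ℂ, P y *ᵥ v = μ • v :=
    fun y hy => hv y (Submodule.mem_sup_left hy)
  have hvC : ∀ y ∈ isotropicPart ω C z', ∃ μ : ℂ, P y *ᵥ v = μ • v :=
    fun y hy => hv y (Submodule.mem_sup_right hy)
  have hf : ∀ m : ι' → k, ∑ i, m i • x' i ∈ ω.orthogonal D := fun m =>
    hCD (C.sum_mem fun i _ => C.smul_mem _ (h'.mem_x i))
  have hg : ∀ b : ι → k, ∑ i, b i • x i ∈ ω.orthogonal C := fun b =>
    hDC (D.sum_mem fun i _ => D.smul_mem _ (h.mem_x i))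
  have hcomm : ∀ (m : ι' → k) (b : ι → k),
      P (∑ i, m i • x' i) *ᵥ P (∑ i, b i • x i) *ᵥ v =
        P (∑ i, b i • x i) *ᵥ P (∑ i, m i • x' i) *ᵥ v := fun m b => by
    rw [hP.mulVec_mulVec_comm, hg b _ (C.sum_mem fun i _ => C.smul_mem _ (h'.mem_x i)),
      AddChar.map_zero_eq_one, one_smul]
  refine ⟨fun m b => P (∑ i, m i • x' i) *ᵥ P (∑ i, b i • x i) *ᵥ v, fun m b m' b' => ?_, ?_, ?_⟩
  · split_ifs with heq
    · rw [heq.1, heq.2, star_mulVec_dotProduct_mulVec (hP.unitary _),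
        star_mulVec_dotProduct_mulVec (hP.unitary _), hv1]
    · by_cases hm : m = m'
      · rw [hcomm, hcomm]
        exact h.star_dotProduct_eq_zero hω hψ hP hv1 hvD (fun hb => heq ⟨hm, hb⟩) (hf m) (hf m')
      · exact h'.star_dotProduct_eq_zero hω hψ hP hv1 hvC hm (hg b) (hg b')
  · rintro _ ⟨u, hu, rfl⟩
    obtain ⟨γ, hγ⟩ := h'.exists_mulVec_eq_smul hω hP hvC hu
    exact ⟨fun m => m + fun i => ω u (z' i), γ, fun m b => hγ m _ (hg b)⟩
  · rintro _ ⟨w, hw, rfl⟩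
    obtain ⟨γ, hγ⟩ := h.exists_mulVec_eq_smul hω hP hvD hw
    refine ⟨Equiv.addRight fun i => ω w (z i), γ, fun m b => ?_⟩
    rw [hcomm, hγ b _ (hf m), hcomm]
    rfl

end Action

end LogicalBasisConstruction

section Existence

open Matrix

namespace EAEncoder

variable {q n k c : ℕ} (𝒬 : EAEncoder q n k c)

theorem conjTranspose_encoding_mul_kronecker_mul_encoding_apply
    (E : Matrix (Fin n → Fin q) (Fin n → Fin q) ℂ) (m m' : Fin k → Fin q) :
    (𝒬.encodingᴴ * (E ⊗ₖ (1 : Matrix (Fin c → Fin q) (Fin c → Fin q) ℂ)) * 𝒬.encoding) m m' =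
      ((q : ℂ) ^ c)⁻¹ *
        ∑ b, star (fun x => 𝒬.V x (m, b)) ⬝ᵥ (E *ᵥ fun y => 𝒬.V y (m', b)) := by
  have hsqrt : (((√((q : ℝ) ^ c) : ℝ) : ℂ))⁻¹ * (((√((q : ℝ) ^ c) : ℝ) : ℂ))⁻¹ =
      ((q : ℂ) ^ c)⁻¹ := by
    rw [← mul_inv, ← Complex.ofReal_mul, Real.mul_self_sqrt (by positivity)]
    simp
  have hright : ∀ x b, ((E ⊗ₖ (1 : Matrix (Fin c → Fin q) (Fin c → Fin q) ℂ)) * 𝒬.encoding)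
      (x, b) m' = (E *ᵥ fun y => 𝒬.V y (m', b)) x / ((√((q : ℝ) ^ c) : ℝ) : ℂ) := fun x b => by
    simp [mul_apply, Fintype.sum_prod_type, encoding, one_apply, mulVec, dotProduct, mul_div_assoc,
      Finset.sum_div]
  rw [Matrix.mul_assoc, mul_apply, Fintype.sum_prod_type_right, Finset.mul_sum]
  refine Finset.sum_congr rfl fun b _ => ?_
  rw [dotProduct, Finset.mul_sum]
  refine Finset.sum_congr rfl fun x _ => ?_
  rw [hright, ← hsqrt, conjTranspose_apply, encoding, star_div₀, Complex.star_def,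
    Complex.conj_ofReal, Pi.star_apply, Complex.star_def]
  ring

theorem detects_iff (hq : q ≠ 0) (E : Matrix (Fin n → Fin q) (Fin n → Fin q) ℂ) :
    𝒬.Detects E ↔ ∃ ζ : ℂ, ∀ m m', ∑ b, star (fun x => 𝒬.V x (m, b)) ⬝ᵥ
      (E *ᵥ fun y => 𝒬.V y (m', b)) = if m = m' then ζ else 0 := by
  have hqc : (q : ℂ) ^ c ≠ 0 := pow_ne_zero _ (Nat.cast_ne_zero.2 hq)
  have hiff : ∀ ζ : ℂ, 𝒬.encodingᴴ * (E ⊗ₖ (1 : Matrix (Fin c → Fin q) (Fin c → Fin q) ℂ)) *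
      𝒬.encoding = (ζ • 1 : Matrix (Fin k → Fin q) (Fin k → Fin q) ℂ) ↔
      ∀ m m', ∑ b, star (fun x => 𝒬.V x (m, b)) ⬝ᵥ (E *ᵥ fun y => 𝒬.V y (m', b)) =
        if m = m' then (q : ℂ) ^ c * ζ else 0 := fun ζ => by
    simp only [← Matrix.ext_iff, conjTranspose_encoding_mul_kronecker_mul_encoding_apply,
      Matrix.smul_apply, one_apply, smul_eq_mul, mul_ite, mul_one, mul_zero,
      inv_mul_eq_iff_eq_mul₀ hqc]
  simp only [Detects, hiff]
  exact (mul_left_surjective₀ hqc).exists (p := fun ζ => ∀ m m', ∑ b,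
    star (fun x => 𝒬.V x (m, b)) ⬝ᵥ (E *ᵥ fun y => 𝒬.V y (m', b)) = if m = m' then ζ else 0) |>.symm

/-- The errors which are detected by a code; they form a linear space. -/
def detectable : Submodule ℂ (Matrix (Fin n → Fin q) (Fin n → Fin q) ℂ) where
  carrier := {E | 𝒬.Detects E}
  zero_mem' := ⟨0, by simp⟩
  add_mem' := by
    rintro E E' ⟨z, hz⟩ ⟨z', hz'⟩
    exact ⟨z + z', by rw [add_kronecker, Matrix.mul_add, Matrix.add_mul, hz, hz', add_smul]⟩
  smul_mem' := by
    rintro a E ⟨z, hz⟩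
    exact ⟨a * z, by rw [smul_kronecker, Matrix.mul_smul, Matrix.smul_mul, hz, mul_smul]⟩

end EAEncoder

theorem exists_map_apply_ne_one {k V : Type*} [Field k] [AddCommGroup V] [Module k V]
    {ψ : AddChar k ℂ} (hψ : ψ.IsPrimitive) {ω : LinearMap.BilinForm k V} {W : Submodule k V} {u : V}
    (hu : u ∉ ω.orthogonal W) :
    ∃ w ∈ W, ψ (ω w u) ≠ 1 := by
  obtain ⟨w, hw, hwu⟩ : ∃ w ∈ W, ω w u ≠ 0 := by
    by_contra! h
    exact hu h
  obtain ⟨t, ht⟩ := exists_map_mul_ne hψ hwu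
  exact ⟨t • w, W.smul_mem t hw, by simpa using ht⟩

variable {q n : ℕ} {k G : Type*} [Field k] [AddCommGroup G] [Module k G]
  [DecidableEq G] {ψ : AddChar k ℂ} {ω : LinearMap.BilinForm k G}

theorem IsLogicalBasis.existsEAQEC {K c d : ℕ}
    {P : (Fin n → G) → Matrix (Fin n → Fin q) (Fin n → Fin q) ℂ} (hq : q ≠ 0)
    (hP : IsQuditErrorBasis ψ ω P) (hψ : ψ.IsPrimitive) {C D : Submodule k (Fin n → G)}
    (hC : (piForm (Fin n) ω).orthogonal D = C) (hD : (piForm (Fin n) ω).orthogonal C = D)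
    (hmin : ∀ u ∈ C, u ≠ 0 → d ≤ hammingNorm u) (hd : ∃ u ∈ C, u ∉ D ∧ hammingNorm u = d)
    {Φ : (Fin K → Fin q) → (Fin c → Fin q) → (Fin n → Fin q) → ℂ}
    (hΦ : IsLogicalBasis (P '' C) (P '' D) Φ) : ExistsEAQEC q n K d c := by
  have : NeZero q := ⟨hq⟩
  let 𝒬 : EAEncoder q n K c :=
    { V := Matrix.of fun y mb => Φ mb.1 mb.2 y
      isometry := by
        ext ⟨m, b⟩ ⟨m', b'⟩
        rw [one_apply, ← if_congr Prod.mk_inj.symm rfl rfl]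
        exact hΦ.orthonormal m b m' b' }
  have hdet : ∀ u, hammingNorm u < d → 𝒬.Detects (P u) := fun u hu => by
    rw [𝒬.detects_iff hq]
    by_cases huC : u ∈ C
    · have hu0 : u = 0 := by
        by_contra h0
        exact (hmin u huC h0).not_gt hu
      refine ⟨Fintype.card (Fin c → Fin q), fun m m' => ?_⟩
      simp only [hu0, hP.zero, one_mulVec]
      refine (Finset.sum_congr rfl fun b _ => hΦ.orthonormal m b m' b).trans ?_
      split_ifs with h <;> simp [h]
    · obtain ⟨w, hw, hwu⟩ := exists_map_apply_ne_one hψ (hC ▸ huC)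
      exact ⟨0, fun m m' => (hΦ.sum_dotProduct_eq_zero hP.toIsErrorBasis
        (Set.mem_image_of_mem P hw) hwu m m').trans (ite_self _).symm⟩
  refine ⟨𝒬, ?_, ?_⟩
  · obtain ⟨u, huC, huD, rfl⟩ := hd
    refine ⟨_, rfl, P u, hP.actsOn fun i hi => by simpa using hi, ?_⟩
    rw [𝒬.detects_iff hq]
    obtain ⟨w, hw, hwu⟩ := exists_map_apply_ne_one hψ (hD ▸ huD)
    rintro ⟨ζ, hζ⟩
    exact hΦ.sum_dotProduct_ne_scalar hP.toIsErrorBasis (Set.mem_image_of_mem P huC)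
      (Set.mem_image_of_mem P hw) hwu ζ hζ
  · rintro _ ⟨T, rfl, E, hE, hnot⟩
    by_contra! hlt
    refine hnot ((Submodule.span_le (p := 𝒬.detectable)).2 ?_ (hP.mem_span hE))
    rintro _ ⟨u, hu, rfl⟩
    refine hdet u (lt_of_le_of_lt (Finset.card_le_card fun i hi => ?_) hlt)
    by_contra hiT
    simp [hu i hiT] at hi

theorem existsEAQEC_of_orthogonal [Finite k] (hcard : Nat.card k = q) (hω : ω.IsAlt)
    (hnd : ω.Nondegenerate) (hG : Module.finrank k G = 2) {K c d : ℕ}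
    {C D : Submodule k (Fin n → G)}
    (hC : (piForm (Fin n) ω).orthogonal D = C) (hD : (piForm (Fin n) ω).orthogonal C = D)
    (hK : Module.finrank k C = Module.finrank k (C ⊓ D : Submodule k (Fin n → G)) + 2 * K)
    (hc : Module.finrank k D = Module.finrank k (C ⊓ D : Submodule k (Fin n → G)) + 2 * c)
    (hmin : ∀ u ∈ C, u ≠ 0 → d ≤ hammingNorm u) (hd : ∃ u ∈ C, u ∉ D ∧ hammingNorm u = d) :
    ExistsEAQEC q n K d c := by
  classical
  have : Fintype k := Fintype.ofFinite k
  have : FiniteDimensional k G := Module.finite_of_finrank_eq_succ hG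
  have : Finite G := Module.finite_of_finite k
  have hq : q ≠ 0 := hcard ▸ Nat.card_pos.ne'
  have : NeZero q := ⟨hq⟩
  obtain ⟨ε⟩ : Nonempty (Fin q ≃ k) := ⟨(finCongr hcard.symm).trans (Finite.equivFin k).symm⟩
  have hψ := AddChar.FiniteField.primitiveChar_to_Complex_isPrimitive k
  obtain ⟨P, hP⟩ := exists_isQuditErrorBasis (n := n) ε hψ hω hnd hG
  have hω' := piForm_isAlt (ι := Fin n) hω
  obtain ⟨m, x, z, h⟩ := exists_isHyperbolicBasis D hω'
  obtain ⟨m', x', z', h'⟩ := exists_isHyperbolicBasis C hω'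
  have hm : m = c := by
    have := h.finrank_eq hω'
    rw [hC, inf_comm, Fintype.card_fin] at this
    lia
  have hm' : m' = K := by
    have := h'.finrank_eq hω'
    rw [hD, Fintype.card_fin] at this
    lia
  subst hm hm'
  obtain ⟨Φ, hΦ⟩ := exists_isLogicalBasis hω' hψ hP.toIsErrorBasis hC.ge h h'
  exact (hΦ.reindex (Equiv.piCongrRight fun _ => ε) (Equiv.piCongrRight fun _ => ε)).existsEAQEC
    hq hP hψ hC hD hmin hd

end Existence

section TraceForm

theorem nondegenerate_piForm {ι k V : Type*} [Fintype ι] [Field k] [AddCommGroup V] [Module k V]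
    {ω : LinearMap.BilinForm k V} (hω : ω.IsAlt) (hnd : ω.Nondegenerate) :
    (piForm ι ω).Nondegenerate := by
  classical
  refine (piForm_isAlt hω).isRefl.nondegenerate_iff_separatingLeft.2 fun u hu =>
    funext fun i => hnd.1 _ fun x => ?_
  have := hu (Pi.single i x)
  rwa [piForm_apply, Finset.sum_eq_single_of_mem i (Finset.mem_univ i) fun j _ hj => by
    rw [Pi.single_eq_of_ne hj, map_zero], Pi.single_eq_same] at this

/-- The trace-Hermitian form `Tr (β x y ^ q)` of an extension of the field `k` with `q` elements.
For a quadratic extension it is alternating if `β ^ q = -β`. -/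
noncomputable def traceHermitianForm (k : Type*) {F : Type*} [Field k] [Fintype k] [Field F]
    [Algebra k F] (β : F) : LinearMap.BilinForm k F :=
  (Algebra.traceForm k F).compl₁₂ (LinearMap.mulLeft k β)
    (FiniteField.frobeniusAlgHom k F).toLinearMap

variable {k F : Type*} [Field k] [Fintype k] [Field F] [Algebra k F]

theorem traceHermitianForm_apply (β x y : F) :
    traceHermitianForm k β x y = Algebra.trace k F (β * x * y ^ Fintype.card k) := rfl

variable [Finite F] (h2 : Module.finrank k F = 2)
include h2

theorem pow_card_pow_card_of_finrank_eq_two (x : F) :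
    (x ^ Fintype.card k) ^ Fintype.card k = x := by
  have := Fintype.ofFinite F
  rw [← pow_mul, ← sq, ← h2, ← Module.card_eq_pow_finrank, FiniteField.pow_card]

theorem exists_pow_card_eq_neg : ∃ β : F, β ≠ 0 ∧ β ^ Fintype.card k = -β := by
  let φ := FiniteField.frobeniusAlgHom k F
  obtain ⟨x, hx⟩ : ∃ x, φ x ≠ x := by
    by_contra! h
    have h1 := FiniteField.orderOf_frobeniusAlgHom k F
    rw [orderOf_eq_one_iff.2 (AlgHom.ext h), h2] at h1
    lia
  have hφφ : φ (φ x) = x := pow_card_pow_card_of_finrank_eq_two h2 x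
  refine ⟨φ x - x, sub_ne_zero.2 hx, ?_⟩
  change φ (φ x - x) = _
  rw [map_sub, hφφ, neg_sub]

theorem traceHermitianForm_isAlt {β : F} (hβ : β ^ Fintype.card k = -β) :
    (traceHermitianForm k β).IsAlt := fun x => by
  apply FaithfulSMul.algebraMap_injective k F
  rw [traceHermitianForm_apply, FiniteField.algebraMap_trace_eq_sum_pow, h2, Finset.sum_range_succ,
    Finset.sum_range_one, pow_zero, pow_one, pow_one, Nat.card_eq_fintype_card, mul_pow, mul_pow,
    hβ, pow_card_pow_card_of_finrank_eq_two h2, map_zero]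
  ring

theorem traceHermitianForm_nondegenerate {β : F} (hβ : β ^ Fintype.card k = -β) (hβ0 : β ≠ 0) :
    (traceHermitianForm k β).Nondegenerate := by
  refine (traceHermitianForm_isAlt h2 hβ).isRefl.nondegenerate_iff_separatingLeft.2 fun x hx =>
    (mul_eq_zero_iff_left hβ0).1 ((traceForm_nondegenerate k F).1 (β * x) fun y => ?_)
  have := hx (y ^ Fintype.card k)
  rwa [traceHermitianForm_apply, pow_card_pow_card_of_finrank_eq_two h2] at this

theorem orthogonal_piForm_traceHermitianForm {n : ℕ} {β : F} (hβ : β ^ Fintype.card k = -β)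
    (hβ0 : β ≠ 0) {C D : Submodule F (Fin n → F)}
    (hdim : Module.finrank F C + Module.finrank F D = n)
    (horth : ∀ c ∈ C, ∀ d ∈ D, ∑ i, c i * d i ^ Fintype.card k = 0) :
    (piForm (Fin n) (traceHermitianForm k β)).orthogonal (C.restrictScalars k) =
      D.restrictScalars k := by
  have hfin : ∀ W : Submodule F (Fin n → F),
      Module.finrank k (W.restrictScalars k) = 2 * Module.finrank F W := fun W => by
    rw [← h2]
    exact (Module.finrank_mul_finrank k F W).symm
  refine (Submodule.eq_of_le_of_finrank_eq ?_ ?_).symm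
  · intro d hd c hc
    change piForm (Fin n) (traceHermitianForm k β) c d = 0
    simp only [piForm_apply, traceHermitianForm_apply]
    rw [← map_sum]
    simp only [mul_assoc, ← Finset.mul_sum, horth c hc d hd, mul_zero, map_zero]
  · rw [LinearMap.BilinForm.finrank_orthogonal (nondegenerate_piForm
      (traceHermitianForm_isAlt h2 hβ) (traceHermitianForm_nondegenerate h2 hβ hβ0)), hfin, hfin,
      ← Module.finrank_mul_finrank k F, h2, Module.finrank_fin_fun]
    lia

end TraceForm

section RootCode

open Polynomial

variable {F K : Type*} [Field F] [Field K] [Algebra F K] {n : ℕ}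

/-- The polynomial of a word as a linear map. -/
noncomputable def wordPolyLinear (F : Type*) [Field F] (n : ℕ) : (Fin n → F) →ₗ[F] F[X] where
  toFun := wordPoly
  map_add' c d := by simp [wordPoly, add_mul, Finset.sum_add_distrib]
  map_smul' a c := by simp [wordPoly, Finset.smul_sum, smul_eq_C_mul, mul_assoc]

theorem wordPolyLinear_apply (c : Fin n → F) : wordPolyLinear F n c = wordPoly c := rfl

theorem aeval_wordPoly (c : Fin n → F) (ρ : K) :
    aeval ρ (wordPoly c) = ∑ i : Fin n, algebraMap F K (c i) * ρ ^ (i : ℕ) := by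
  simp [wordPoly]

theorem wordPoly_coeff {p : F[X]} (hp : p.natDegree < n) :
    wordPoly (fun i : Fin n => p.coeff i) = p := by
  rw [wordPoly, Fin.sum_univ_eq_sum_range (fun i => C (p.coeff i) * X ^ i) n]
  simpa only [C_mul_X_pow_eq_monomial] using (p.as_sum_range' n hp).symm

/-- The code of the words whose polynomials vanish on `Y`. -/
noncomputable def rootCode (F : Type*) {K : Type*} [Field F] [Field K] [Algebra F K] (n : ℕ)
    (Y : Finset K) : Submodule F (Fin n → F) :=
  ⨅ ρ ∈ Y, LinearMap.ker ((aeval ρ).toLinearMap ∘ₗ wordPolyLinear F n)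

theorem mem_rootCode {Y : Finset K} {c : Fin n → F} :
    c ∈ rootCode F n Y ↔ ∀ ρ ∈ Y, aeval ρ (wordPoly c) = 0 := by
  simp [rootCode, wordPolyLinear_apply]

theorem aeval_constacyclicShift {α : F} {ρ : K} (hρ : ρ ^ n = algebraMap F K α)
    (c : Fin n → F) :
    aeval ρ (wordPoly (constacyclicShift α c)) = ρ * aeval ρ (wordPoly c) := by
  rw [aeval_wordPoly, aeval_wordPoly]
  cases n with
  | zero => simp
  | succ n =>
    have hsucc : ∀ i : Fin n, constacyclicShift α c i.succ = c i.castSucc := fun i => by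
      simp [constacyclicShift, Fin.castSucc, Fin.castAdd, Fin.castLE]
    have hzero : constacyclicShift α c 0 = α * c (Fin.last n) := by
      simp [constacyclicShift, Fin.last]
    rw [Fin.sum_univ_succ, Fin.sum_univ_castSucc (n := n), mul_add, Finset.mul_sum, add_comm]
    simp only [hsucc, hzero, Fin.val_zero, Fin.val_succ, Fin.val_castSucc, Fin.val_last, map_mul,
      ← hρ]
    congr 1
    · exact Finset.sum_congr rfl fun i _ => by ring
    · ring

theorem rootCode_isConstacyclic {α : F} {Y : Finset K}
    (hY : ∀ ρ ∈ Y, ρ ^ n = algebraMap F K α) : IsConstacyclic α (rootCode F n Y) := fun c hc =>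
  mem_rootCode.2 fun ρ hρ => by
    rw [aeval_constacyclicShift (hY ρ hρ), mem_rootCode.1 hc ρ hρ, mul_zero]

theorem prod_X_sub_C_dvd_map_iff (Y : Finset K) (p : F[X]) :
    ∏ ρ ∈ Y, (X - C ρ) ∣ p.map (algebraMap F K) ↔ ∀ ρ ∈ Y, aeval ρ p = 0 := by
  have hroot : ∀ ρ, X - C ρ ∣ p.map (algebraMap F K) ↔ aeval ρ p = 0 := fun ρ => by
    rw [dvd_iff_isRoot, IsRoot, eval_map_algebraMap]
  simp only [← hroot]
  exact ⟨fun h ρ hρ => (Finset.dvd_prod_of_mem (fun ρ => X - C ρ) hρ).trans h,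
    Finset.prod_dvd_of_coprime fun a _ b _ hab =>
      isCoprime_X_sub_C_of_isUnit_sub (sub_ne_zero.2 hab).isUnit⟩

section Generator

variable {Y : Finset K} {g : F[X]}

theorem dvd_iff_of_map_eq (hg : g.map (algebraMap F K) = ∏ ρ ∈ Y, (X - C ρ)) (p : F[X]) :
    g ∣ p ↔ ∀ ρ ∈ Y, aeval ρ p = 0 := by
  rw [← map_dvd_map' (algebraMap F K), hg, prod_X_sub_C_dvd_map_iff]

theorem natDegree_of_map_eq (hg : g.map (algebraMap F K) = ∏ ρ ∈ Y, (X - C ρ)) :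
    g.natDegree = Y.card := by
  rw [← natDegree_map (algebraMap F K), hg, natDegree_finsetProd_X_sub_C_eq_card]

theorem isGeneratorPoly_rootCode {α : F} (hg : g.map (algebraMap F K) = ∏ ρ ∈ Y, (X - C ρ))
    (hmonic : g.Monic) (hY : ∀ ρ ∈ Y, ρ ^ n = algebraMap F K α) :
    IsGeneratorPoly α (rootCode F n Y) g := by
  refine ⟨hmonic, (dvd_iff_of_map_eq hg _).2 fun ρ hρ => ?_, fun c => ?_⟩
  · simp [hY ρ hρ]
  · rw [dvd_iff_of_map_eq hg, mem_rootCode]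

theorem finrank_add_natDegree_of_mem_iff_dvd {C : Submodule F (Fin n → F)} (hmonic : g.Monic)
    (hn : g.natDegree ≤ n) (hC : ∀ c : Fin n → F, c ∈ C ↔ g ∣ wordPoly c) :
    Module.finrank F C + g.natDegree = n := by
  let f : (Fin n → F) →ₗ[F] AdjoinRoot g := (AdjoinRoot.mkₐ g).toLinearMap ∘ₗ wordPolyLinear F n
  have hf : ∀ c, f c = AdjoinRoot.mk g (wordPoly c) := fun c => rfl
  have hsurj : Function.Surjective f := by
    intro y
    obtain ⟨p, rfl⟩ := AdjoinRoot.mk_surjective y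
    by_cases hg1 : g = 1
    · refine ⟨0, ?_⟩
      rw [hf, AdjoinRoot.mk_eq_mk, hg1]
      exact one_dvd _
    refine ⟨fun i => (p %ₘ g).coeff i, ?_⟩
    rw [hf, wordPoly_coeff ((natDegree_modByMonic_lt p hmonic hg1).trans_le hn),
      AdjoinRoot.mk_eq_mk]
    exact ⟨-(p /ₘ g), by linear_combination modByMonic_add_div p g⟩
  have hker : LinearMap.ker f = C := by
    ext c
    rw [LinearMap.mem_ker, hf, AdjoinRoot.mk_eq_zero, hC]
  have hrank := LinearMap.finrank_range_add_finrank_ker f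
  rw [LinearMap.range_eq_top.2 hsurj, finrank_top, hker, Module.finrank_fin_fun,
    (AdjoinRoot.powerBasis' hmonic).finrank, AdjoinRoot.powerBasis'_dim] at hrank
  lia

end Generator

section Frobenius

variable [Finite F]

theorem mem_range_algebraMap_of_pow_card {x : K} (hx : x ^ Nat.card F = x) :
    x ∈ Set.range (algebraMap F K) := by
  exact (splits_X_pow_nat_card_sub_X (K := F)).mem_range_of_isRoot
    (FiniteField.X_pow_card_sub_X_ne_zero F Finite.one_lt_card) (by simp [hx])

theorem exists_map_eq_prod (Y : Finset K) (hY : ∀ ρ ∈ Y, ρ ^ Nat.card F ∈ Y) :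
    ∃ g : F[X], g.Monic ∧ g.map (algebraMap F K) = ∏ ρ ∈ Y, (X - C ρ) := by
  classical
  have := Fintype.ofFinite F
  let φ : K →+* K := (FiniteField.frobeniusAlgHom F K).toRingHom
  have hφ : ∀ x, φ x = x ^ Nat.card F := fun x => by
    rw [Nat.card_eq_fintype_card]; rfl
  have himg : Y.image φ = Y := Finset.eq_of_subset_of_card_le
    (Finset.image_subset_iff.2 fun ρ hρ => hφ ρ ▸ hY ρ hρ)
    (Finset.card_image_of_injective _ φ.injective).ge
  have hfix : (∏ ρ ∈ Y, (X - C ρ)).map φ = ∏ ρ ∈ Y, (X - C ρ) := by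
    conv_rhs => rw [← himg, Finset.prod_image φ.injective.injOn]
    simp only [Polynomial.map_prod, Polynomial.map_sub, map_X, map_C]
  have hlifts : ∏ ρ ∈ Y, (X - C ρ) ∈ lifts (algebraMap F K) :=
    (lifts_iff_coeff_lifts _).2 fun i => mem_range_algebraMap_of_pow_card (by
      rw [← hφ, ← coeff_map, hfix])
  obtain ⟨g, hg, -, hgm⟩ := lifts_and_natDegree_eq_and_monic hlifts
    (monic_prod_X_sub_C id Y)
  exact ⟨g, hgm, hg⟩

theorem finrank_rootCode {Y : Finset K} (hY : ∀ ρ ∈ Y, ρ ^ Nat.card F ∈ Y)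
    (hn : Y.card ≤ n) : Module.finrank F (rootCode F n Y) + Y.card = n := by
  obtain ⟨g, hmonic, hg⟩ := exists_map_eq_prod Y hY
  rw [← natDegree_of_map_eq hg] at hn ⊢
  exact finrank_add_natDegree_of_mem_iff_dvd hmonic hn fun c => by
    rw [dvd_iff_of_map_eq hg, mem_rootCode]

end Frobenius

theorem map_eq_prod_of_mul_eq {f g h : F[X]} (hgh : f = g * h) (hg : g.Monic)
    (hh : h ≠ 0) {Ω Y : Finset K} (hΩ : ∀ ρ ∈ Ω, aeval ρ f = 0) (hcard : f.natDegree ≤ Ω.card)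
    (hYΩ : Y ⊆ Ω) (hY : ∀ ρ ∈ Ω, aeval ρ g = 0 ↔ ρ ∈ Y) :
    g.map (algebraMap F K) = ∏ ρ ∈ Y, (X - C ρ) := by
  classical
  have hdvd : ∏ ρ ∈ Ω \ Y, (X - C ρ) ∣ h.map (algebraMap F K) := by
    rw [prod_X_sub_C_dvd_map_iff]
    intro ρ hρ
    rw [Finset.mem_sdiff] at hρ
    have hmul : aeval ρ g * aeval ρ h = 0 := by
      rw [← map_mul, ← hgh, hΩ ρ hρ.1]
    exact (mul_eq_zero.1 hmul).resolve_left fun h0 => hρ.2 ((hY ρ hρ.1).1 h0)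
  have hsdiff : Ω.card - Y.card ≤ h.natDegree := by
    have := natDegree_le_of_dvd hdvd (map_ne_zero hh)
    rwa [natDegree_map, natDegree_finsetProd_X_sub_C_eq_card,
      Finset.card_sdiff_of_subset hYΩ] at this
  have hdeg : f.natDegree = g.natDegree + h.natDegree := by rw [hgh, natDegree_mul hg.ne_zero hh]
  refine eq_of_monic_of_dvd_of_natDegree_le (monic_prod_X_sub_C id Y) (hg.map _) ?_ ?_
  · exact (prod_X_sub_C_dvd_map_iff Y g).2 fun ρ hρ => (hY ρ (hYΩ hρ)).2 hρ
  · rw [natDegree_map]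
    refine le_of_le_of_eq ?_ (natDegree_finsetProd_X_sub_C_eq_card Y id).symm
    lia

theorem IsGeneratorPoly.eq_rootCode {α : F} {C : Submodule F (Fin n → F)}
    {g : F[X]} (hg : IsGeneratorPoly α C g) {Ω Y : Finset K}
    (hΩ : ∀ ρ ∈ Ω, ρ ^ n = algebraMap F K α) (hcard : Ω.card = n) (hYΩ : Y ⊆ Ω)
    (hY : ∀ ρ ∈ Ω, aeval ρ g = 0 ↔ ρ ∈ Y) : C = rootCode F n Y := by
  obtain ⟨hmonic, ⟨h, hgh⟩, hC⟩ := hg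
  rcases Nat.eq_zero_or_pos n with rfl | hn
  · exact Subsingleton.elim _ _
  have hh : h ≠ 0 := right_ne_zero_of_mul (hgh ▸ X_pow_sub_C_ne_zero hn α)
  have hprod := map_eq_prod_of_mul_eq hgh hmonic hh (fun ρ hρ => by simp [hΩ ρ hρ])
    (natDegree_X_pow_sub_C.trans hcard.symm).le hYΩ hY
  ext c
  rw [hC, dvd_iff_of_map_eq hprod, mem_rootCode]

-- The BCH bound: the coordinates `cᵢ γⁱ` in the support solve a Vandermonde system.
theorem lt_hammingNorm_of_roots [DecidableEq F] {w : ℕ} {θ γ : K} (hθ : IsPrimitiveRoot θ n)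
    (hγ : γ ≠ 0) {c : Fin n → F} (hc : c ≠ 0)
    (hroot : ∀ u < w, aeval (γ * θ ^ u) (wordPoly c) = 0) : w < hammingNorm c := by
  by_contra! hle
  let S : Finset (Fin n) := {i | c i ≠ 0}
  let e : Fin S.card ≃ S := S.equivFin.symm
  let a : Fin n → K := fun i => algebraMap F K (c i) * γ ^ (i : ℕ)
  have hinj : Function.Injective fun j => θ ^ ((e j : Fin n) : ℕ) := fun i j hij =>
    e.injective (Subtype.ext (Fin.ext (hθ.pow_inj (Fin.is_lt _) (Fin.is_lt _) hij)))
  have hsum : ∀ u : Fin S.card, ∑ j, a (e j) * (θ ^ ((e j : Fin n) : ℕ)) ^ (u : ℕ) = 0 := by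
    intro u
    rw [e.sum_comp fun i : S => a i * (θ ^ ((i : Fin n) : ℕ)) ^ (u : ℕ),
      Finset.sum_coe_sort S fun i => a i * (θ ^ (i : ℕ)) ^ (u : ℕ),
      ← hroot u (u.2.trans_le hle), aeval_wordPoly]
    refine Finset.sum_subset_zero_on_sdiff (Finset.subset_univ S) (fun i hi => ?_) fun i _ => ?_
    · simp_all [S]
    · simp only [a]
      ring
  have ha := Matrix.eq_zero_of_forall_pow_sum_mul_pow_eq_zero hinj hsum
  obtain ⟨i, hi⟩ := Function.ne_iff.mp hc
  have hai := congrFun ha (e.symm ⟨i, by simpa [S] using hi⟩)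
  exact hi (by simpa [a, hγ] using hai)

end RootCode

section MDS

variable {F : Type*} [Field F] {n w : ℕ} {C D : Submodule F (Fin n → F)}

theorem exists_mem_support_subset (hdim : Module.finrank F C + w = n) {S : Finset (Fin n)}
    (hS : S.card = w + 1) : ∃ c ∈ C, c ≠ 0 ∧ ∀ i ∉ S, c i = 0 := by
  let f : C →ₗ[F] ({i // i ∉ S} → F) :=
    (LinearMap.pi fun i : {i // i ∉ S} => LinearMap.proj (i : Fin n)).domRestrict C
  have hcard : Fintype.card {i // i ∉ S} = n - (w + 1) := by
    rw [Fintype.card_subtype_compl, Fintype.card_fin, Fintype.card_coe, hS]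
  have hle : w + 1 ≤ n := by simpa [hS] using S.card_le_univ
  have hker : LinearMap.ker f ≠ ⊥ := f.ker_ne_bot_of_finrank_lt (by
    rw [Module.finrank_fintype_fun_eq_card, hcard]
    lia)
  obtain ⟨c, hc, hc0⟩ := Submodule.exists_mem_ne_zero_of_ne_bot hker
  exact ⟨c, c.2, fun h => hc0 (Subtype.ext h), fun i hi =>
    congrFun (LinearMap.mem_ker.1 hc) ⟨i, hi⟩⟩

variable [DecidableEq F]

theorem hammingNorm_sub_smul_lt {ι : Type*} [Fintype ι] {b c : ι → F}
    (hbc : ∀ j, c j = 0 → b j = 0) {i : ι} (hi : b i ≠ 0) :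
    hammingNorm (c - (c i / b i) • b) < hammingNorm c := by
  refine Finset.card_lt_card ((Finset.ssubset_iff_of_subset fun j hj => ?_).2 ⟨i, ?_, ?_⟩)
  · rw [Finset.mem_filter_univ] at hj ⊢
    exact fun hcj => hj (by simp [hcj, hbc j hcj])
  · exact (Finset.mem_filter_univ i).2 (mt (hbc i) hi)
  · simp [hi]

theorem le_of_hammingNorm_le_mem (hdim : Module.finrank F C + w = n)
    (hD : ∀ c ∈ C, hammingNorm c ≤ w + 1 → c ∈ D) : C ≤ D := by
  intro c hc
  induction hv : hammingNorm c using Nat.strong_induction_on generalizing c with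
  | _ v ih =>
    subst hv
    rcases le_or_gt (hammingNorm c) (w + 1) with hle | hlt
    · exact hD c hc hle
    obtain ⟨S, hSc, hS⟩ := Finset.exists_subset_card_eq hlt.le
    obtain ⟨b, hb, hb0, hbS⟩ := exists_mem_support_subset hdim hS
    obtain ⟨i, hi⟩ := Function.ne_iff.mp hb0
    have hbD : b ∈ D := hD b hb <| hS ▸ Finset.card_le_card fun j hj => by
      by_contra hjS
      exact (Finset.mem_filter_univ j).1 hj (hbS j hjS)
    have hlower := hammingNorm_sub_smul_lt
      (fun j hcj => hbS j fun hjS => (Finset.mem_filter_univ j).1 (hSc hjS) hcj) hi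
    have hcD := ih _ hlower (C.sub_mem hc (C.smul_mem _ hb)) rfl
    simpa using D.add_mem hcD (D.smul_mem (c i / b i) hbD)

theorem exists_min_weight_not_mem (hdim : Module.finrank F C + w = n)
    (hmin : ∀ c ∈ C, c ≠ 0 → w < hammingNorm c) (hCD : ¬ C ≤ D) :
    ∃ c ∈ C, c ∉ D ∧ hammingNorm c = w + 1 := by
  contrapose! hCD
  refine le_of_hammingNorm_le_mem hdim fun c hc hle => ?_
  by_contra hcD
  exact hCD c hc hcD (hle.antisymm (hmin c hc (ne_of_mem_of_not_mem D.zero_mem hcD).symm))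

end MDS

theorem IsParityCheck.ker_mulVecLin {F : Type*} [Field F] {m n : ℕ} {C : Submodule F (Fin n → F)}
    {H : Matrix (Fin m) (Fin n) F} (hH : IsParityCheck C H) : LinearMap.ker H.mulVecLin = C := by
  ext c
  rw [LinearMap.mem_ker, Matrix.mulVecLin_apply, hH.2]

theorem IsParityCheck.add_finrank {F : Type*} [Field F] {m n : ℕ} {C : Submodule F (Fin n → F)}
    {H : Matrix (Fin m) (Fin n) F} (hH : IsParityCheck C H) : m + Module.finrank F C = n := by
  have hrank : H.rank = m := by simpa using hH.1.rank_matrix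
  have hadd := LinearMap.finrank_range_add_finrank_ker H.mulVecLin
  rwa [hH.ker_mulVecLin, Module.finrank_fin_fun, ← Matrix.rank, hrank] at hadd

section HermitianConstruction

variable {k F : Type*} [Field k] [Fintype k] [Field F] [Finite F] [Algebra k F]
  (h2 : Module.finrank k F = 2) {n : ℕ} {C D : Submodule F (Fin n → F)}
include h2

theorem sum_mul_pow_card_comm {c d : Fin n → F} (h : ∑ i, c i * d i ^ Fintype.card k = 0) :
    ∑ i, d i * c i ^ Fintype.card k = 0 := by
  have hconj := congrArg (FiniteField.frobeniusAlgHom k F) h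
  simp only [map_sum, map_mul, map_zero, FiniteField.coe_frobeniusAlgHom,
    pow_card_pow_card_of_finrank_eq_two h2] at hconj
  simpa only [mul_comm] using hconj

theorem existsEAQEC_of_hermitian [DecidableEq F] {K c d : ℕ}
    (hdim : Module.finrank F C + Module.finrank F D = n)
    (horth : ∀ c ∈ C, ∀ d ∈ D, ∑ i, c i * d i ^ Fintype.card k = 0)
    (hK : Module.finrank F C = Module.finrank F (C ⊓ D : Submodule F (Fin n → F)) + K)
    (hc : Module.finrank F D = Module.finrank F (C ⊓ D : Submodule F (Fin n → F)) + c)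
    (hmin : ∀ u ∈ C, u ≠ 0 → d ≤ hammingNorm u) (hd : ∃ u ∈ C, u ∉ D ∧ hammingNorm u = d) :
    ExistsEAQEC (Fintype.card k) n K d c := by
  obtain ⟨β, hβ0, hβ⟩ := exists_pow_card_eq_neg h2
  have hfin : ∀ W : Submodule F (Fin n → F),
      Module.finrank k (W.restrictScalars k) = 2 * Module.finrank F W := fun W => by
    rw [← h2]
    exact (Module.finrank_mul_finrank k F W).symm
  have hinf : C.restrictScalars k ⊓ D.restrictScalars k = (C ⊓ D).restrictScalars k := rfl
  refine existsEAQEC_of_orthogonal Nat.card_eq_fintype_card (traceHermitianForm_isAlt h2 hβ)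
    (traceHermitianForm_nondegenerate h2 hβ hβ0) h2
    (orthogonal_piForm_traceHermitianForm h2 hβ hβ0 (by rwa [add_comm]) fun d hd c hc =>
      sum_mul_pow_card_comm h2 (horth c hc d hd))
    (orthogonal_piForm_traceHermitianForm h2 hβ hβ0 hdim horth) ?_ ?_ hmin hd
  · rw [hinf, hfin, hfin, hK, mul_add]
  · rw [hinf, hfin, hfin, hc, mul_add]

theorem mem_of_forall_sum_mul_pow_card_eq_zero
    (hdim : Module.finrank F C + Module.finrank F D = n)
    (horth : ∀ c ∈ C, ∀ d ∈ D, ∑ i, c i * d i ^ Fintype.card k = 0) {x : Fin n → F}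
    (hx : ∀ c ∈ C, ∑ i, c i * x i ^ Fintype.card k = 0) : x ∈ D := by
  obtain ⟨β, hβ0, hβ⟩ := exists_pow_card_eq_neg h2
  rw [← Submodule.restrictScalars_mem k,
    ← orthogonal_piForm_traceHermitianForm h2 hβ hβ0 hdim horth]
  intro c hc
  change piForm (Fin n) (traceHermitianForm k β) c x = 0
  simp only [piForm_apply, traceHermitianForm_apply, mul_assoc]
  rw [← map_sum, ← Finset.mul_sum, hx c hc, mul_zero, map_zero]

theorem hermTranspose_mulVec_pow_card {m : ℕ} (H : Matrix (Fin m) (Fin n) F) (y : Fin m → F)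
    (j : Fin n) : ((hermTranspose (Fintype.card k) H).mulVec y j) ^ Fintype.card k =
      ∑ i, y i ^ Fintype.card k * H i j := by
  change FiniteField.frobeniusAlgHom k F (∑ i, H i j ^ Fintype.card k * y i) = _
  simp only [map_sum, map_mul, FiniteField.coe_frobeniusAlgHom,
    pow_card_pow_card_of_finrank_eq_two h2, mul_comm]

theorem hermTranspose_mulVec_injective {m : ℕ} {H : Matrix (Fin m) (Fin n) F}
    (hH : LinearIndependent F H.row) :
    Function.Injective (hermTranspose (Fintype.card k) H).mulVecLin := by
  rw [← LinearMap.ker_eq_bot, LinearMap.ker_eq_bot']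
  intro y hy
  have hcomb : ∑ i, y i ^ Fintype.card k • H.row i = 0 := by
    funext j
    have hpow := hermTranspose_mulVec_pow_card h2 H y j
    rw [← Matrix.mulVecLin_apply, hy, Pi.zero_apply, zero_pow Fintype.card_ne_zero] at hpow
    simpa using hpow.symm
  exact funext fun i => eq_zero_of_pow_eq_zero (Fintype.linearIndependent_iff.1 hH _ hcomb i)

theorem range_hermTranspose_mulVecLin (hdim : Module.finrank F C + Module.finrank F D = n)
    (horth : ∀ c ∈ C, ∀ d ∈ D, ∑ i, c i * d i ^ Fintype.card k = 0) {m : ℕ}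
    {H : Matrix (Fin m) (Fin n) F} (hH : IsParityCheck C H) :
    LinearMap.range (hermTranspose (Fintype.card k) H).mulVecLin = D := by
  refine Submodule.eq_of_le_of_finrank_eq ?_ ?_
  · rintro _ ⟨y, rfl⟩
    refine mem_of_forall_sum_mul_pow_card_eq_zero h2 hdim horth fun c hc => ?_
    simp only [Matrix.mulVecLin_apply, hermTranspose_mulVec_pow_card h2, Finset.mul_sum]
    rw [Finset.sum_comm]
    refine Finset.sum_eq_zero fun i _ => ?_
    have hrow : ∑ j, H i j * c j = 0 := congrFun ((hH.2 c).1 hc) i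
    simp only [mul_left_comm (c _), ← Finset.mul_sum, mul_comm (c _), hrow, mul_zero]
  · rw [LinearMap.finrank_range_of_inj (hermTranspose_mulVec_injective h2 hH.1),
      Module.finrank_fin_fun]
    have := hH.add_finrank
    lia

theorem rank_mul_hermTranspose (hdim : Module.finrank F C + Module.finrank F D = n)
    (horth : ∀ c ∈ C, ∀ d ∈ D, ∑ i, c i * d i ^ Fintype.card k = 0) {m : ℕ}
    {H : Matrix (Fin m) (Fin n) F} (hH : IsParityCheck C H) :
    (H * hermTranspose (Fintype.card k) H).rank +
      Module.finrank F (C ⊓ D : Submodule F (Fin n → F)) = Module.finrank F D := by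
  have hadd := LinearMap.finrank_range_add_finrank_ker (H.mulVecLin.domRestrict D)
  rw [LinearMap.range_domRestrict, LinearMap.ker_domRestrict, hH.ker_mulVecLin] at hadd
  rw [Matrix.rank, Matrix.mulVecLin_mul, LinearMap.range_comp,
    range_hermTranspose_mulVecLin h2 hdim horth hH, ← hadd,
    ← Submodule.finrank_map_subtype_eq D, Submodule.map_comap_subtype, inf_comm]

end HermitianConstruction

section Duality

open Polynomial

section Fourier

variable {K : Type*} [Field K] {n : ℕ} {a θ : K}

theorem sum_nthRootsFinset_zpow_eq_zero [NeZero n] (hθ : IsPrimitiveRoot θ n) {m : ℤ}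
    (hm : ¬ (n : ℤ) ∣ m) : ∑ ρ ∈ nthRootsFinset n a, ρ ^ m = 0 := by
  have hθ0 : θ ≠ 0 := hθ.ne_zero (NeZero.ne n)
  have hmem : ∀ ρ, ρ ∈ nthRootsFinset n a ↔ ρ ^ n = a := fun ρ =>
    mem_nthRootsFinset (NeZero.pos n) a
  have hshift : ∑ ρ ∈ nthRootsFinset n a, ρ ^ m = θ ^ m * ∑ ρ ∈ nthRootsFinset n a, ρ ^ m := by
    rw [Finset.mul_sum]
    refine Finset.sum_nbij' (θ⁻¹ * ·) (θ * ·) ?_ ?_ ?_ ?_ ?_ <;> intro ρ hρ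
    · simpa [hmem, mul_pow, hθ.pow_eq_one] using hρ
    · simpa [hmem, mul_pow, hθ.pow_eq_one] using hρ
    · exact mul_inv_cancel_left₀ hθ0 ρ
    · exact inv_mul_cancel_left₀ hθ0 ρ
    · rw [← mul_zpow, mul_inv_cancel_left₀ hθ0]
  refine (mul_eq_zero.1 (?_ : (θ ^ m - 1) * _ = 0)).resolve_left
    (sub_ne_zero.2 (mt (hθ.zpow_eq_one_iff_dvd m).1 hm))
  linear_combination -hshift

theorem sum_nthRootsFinset_zpow_sub [NeZero n] (hθ : IsPrimitiveRoot θ n)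
    (hcard : (nthRootsFinset n a).card = n) (i j : Fin n) :
    ∑ ρ ∈ nthRootsFinset n a, ρ ^ ((j : ℤ) - i) = if i = j then (n : K) else 0 := by
  split_ifs with hij
  · simp [hij, hcard]
  · refine sum_nthRootsFinset_zpow_eq_zero hθ fun hdvd => hij (Fin.ext ?_)
    have := Int.eq_zero_of_abs_lt_dvd hdvd (by rw [abs_lt]; omega)
    omega

variable {F : Type*} [Field F] [Algebra F K]

theorem sum_aeval_mul_aeval_pow_card (k : Type*) [Field k] [Fintype k] [Algebra k K] [NeZero n]
    (hθ : IsPrimitiveRoot θ n) (hcard : (nthRootsFinset n a).card = n) (ha : a ≠ 0)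
    (c d : Fin n → F) :
    ∑ ρ ∈ nthRootsFinset n a,
        aeval (ρ ^ Fintype.card k)⁻¹ (wordPoly c) * aeval ρ (wordPoly d) ^ Fintype.card k =
      n * algebraMap F K (∑ i, c i * d i ^ Fintype.card k) := by
  let φ := FiniteField.frobeniusAlgHom k K
  have hexpand : ∀ ρ ∈ nthRootsFinset n a,
      aeval (ρ ^ Fintype.card k)⁻¹ (wordPoly c) * aeval ρ (wordPoly d) ^ Fintype.card k =
        ∑ i : Fin n, ∑ j : Fin n, algebraMap F K (c i * d j ^ Fintype.card k) *
          φ (ρ ^ ((j : ℤ) - i)) := by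
    intro ρ hρ
    have hρ0 : ρ ≠ 0 := by
      rintro rfl
      rw [mem_nthRootsFinset (NeZero.pos n), zero_pow (NeZero.ne n)] at hρ
      exact ha hρ.symm
    change _ * φ _ = _
    rw [aeval_wordPoly, aeval_wordPoly, map_sum, Finset.sum_mul_sum]
    refine Finset.sum_congr rfl fun i _ => Finset.sum_congr rfl fun j _ => ?_
    simp only [φ, FiniteField.coe_frobeniusAlgHom, map_mul, map_pow, zpow_sub₀ hρ0, zpow_natCast,
      div_eq_mul_inv, inv_pow, pow_right_comm]
    ring
  rw [Finset.sum_congr rfl hexpand, Finset.sum_comm, map_sum, Finset.mul_sum]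
  refine Finset.sum_congr rfl fun i _ => ?_
  rw [Finset.sum_comm]
  simp only [← Finset.mul_sum, ← map_sum, sum_nthRootsFinset_zpow_sub hθ hcard, apply_ite φ,
    map_natCast, map_zero, mul_ite, mul_zero, Finset.sum_ite_eq, Finset.mem_univ, if_true]
  exact mul_comm _ _

end Fourier

theorem mem_of_pow_card_mem {F K : Type*} [Field F] [Finite F] [Field K] [Algebra F K]
    {Y : Finset K} (hY : ∀ ρ ∈ Y, ρ ^ Nat.card F ∈ Y) {ρ : K}
    (hρ : ρ ^ Nat.card F ∈ Y) : ρ ∈ Y := by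
  have := Fintype.ofFinite F
  rw [Nat.card_eq_fintype_card] at hY hρ
  let φ : K ↪ K := ⟨_, (FiniteField.frobeniusAlgHom F K).injective⟩
  have hφ : Y.map φ = Y := Finset.map_eq_of_subset fun σ hσ => by
    obtain ⟨ρ, hρ, rfl⟩ := Finset.mem_map.1 hσ
    exact hY ρ hρ
  rw [← hφ] at hρ
  exact (Finset.mem_map' φ).1 hρ

section DualRoots

variable {K : Type*} [Field K] [DecidableEq K] {n : ℕ} {a : K} {Y : Finset K}

/-- The roots `ρ` of `x ^ n - a` whose conjugate inverse `ρ ^ (-q)` is not in `Y`. They are the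
roots of the Hermitian dual of the code with roots `Y`. -/
noncomputable def dualRoots (q n : ℕ) (a : K) (Y : Finset K) : Finset K :=
  {ρ ∈ nthRootsFinset n a | (ρ ^ q)⁻¹ ∉ Y}

theorem mem_dualRoots {q : ℕ} {ρ : K} :
    ρ ∈ dualRoots q n a Y ↔ ρ ∈ nthRootsFinset n a ∧ (ρ ^ q)⁻¹ ∉ Y :=
  Finset.mem_filter

theorem sum_mul_pow_card_eq_zero_of_mem_rootCode {k F : Type*} [Field k] [Fintype k] [Field F]
    [Algebra F K] [Algebra k K] [NeZero n] {θ : K} (hθ : IsPrimitiveRoot θ n)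
    (hcard : (nthRootsFinset n a).card = n) (ha : a ≠ 0) {c d : Fin n → F}
    (hc : c ∈ rootCode F n Y) (hd : d ∈ rootCode F n (dualRoots (Fintype.card k) n a Y)) :
    ∑ i, c i * d i ^ Fintype.card k = 0 := by
  have hzero : (n : K) * algebraMap F K (∑ i, c i * d i ^ Fintype.card k) = 0 := by
    rw [← sum_aeval_mul_aeval_pow_card k hθ hcard ha]
    refine Finset.sum_eq_zero fun ρ hρ => ?_
    by_cases h : (ρ ^ Fintype.card k)⁻¹ ∈ Y
    · rw [mem_rootCode.1 hc _ h, zero_mul]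
    · rw [mem_rootCode.1 hd ρ (mem_dualRoots.2 ⟨hρ, h⟩), zero_pow Fintype.card_ne_zero, mul_zero]
  have hn : (n : K) ≠ 0 := hθ.neZero'.ne
  exact (map_eq_zero _).1 ((mul_eq_zero.1 hzero).resolve_left hn)

theorem card_filter_conj_inv_mem {k : Type*} [Field k] [Fintype k] [Algebra k K] [NeZero n]
    (ha : a ^ (Fintype.card k + 1) = 1) (hY : Y ⊆ nthRootsFinset n a) :
    ({ρ ∈ nthRootsFinset n a | (ρ ^ Fintype.card k)⁻¹ ∈ Y} : Finset K).card = Y.card := by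
  let τ : K ↪ K := ⟨fun ρ => (ρ ^ Fintype.card k)⁻¹,
    inv_injective.comp (FiniteField.frobeniusAlgHom k K).injective⟩
  have hmem : ∀ ρ, ρ ∈ nthRootsFinset n a ↔ ρ ^ n = a := fun ρ =>
    mem_nthRootsFinset (NeZero.pos n) a
  have hτ : (nthRootsFinset n a).map τ = nthRootsFinset n a := Finset.map_eq_of_subset <| by
    rw [Finset.map_subset_iff_subset_preimage]
    intro ρ hρ
    rw [Finset.mem_preimage, hmem] at *
    change ((ρ ^ Fintype.card k)⁻¹) ^ n = a
    rw [inv_pow, pow_right_comm, hρ]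
    exact inv_eq_of_mul_eq_one_right (by rwa [← pow_succ])
  have hfilter : ({ρ ∈ nthRootsFinset n a | τ ρ ∈ Y} : Finset K).map τ = Y := by
    refine (Finset.filter_map (p := (· ∈ Y))).symm.trans ?_
    rw [hτ, Finset.filter_mem_eq_inter, Finset.inter_eq_right.2 hY]
  exact (Finset.card_map τ).symm.trans (congrArg Finset.card hfilter)

variable {F : Type*} [Field F] [Finite F] [Algebra F K]

theorem dualRoots_stable [NeZero n] {α : F} (q : ℕ) (hY : ∀ ρ ∈ Y, ρ ^ Nat.card F ∈ Y) :
    ∀ ρ ∈ dualRoots q n (algebraMap F K α) Y,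
      ρ ^ Nat.card F ∈ dualRoots q n (algebraMap F K α) Y := by
  intro ρ hρ
  rw [mem_dualRoots, mem_nthRootsFinset (NeZero.pos n)] at hρ ⊢
  refine ⟨?_, fun h => hρ.2 (mem_of_pow_card_mem hY ?_)⟩
  · have := Fintype.ofFinite F
    rw [pow_right_comm, hρ.1, ← map_pow, Nat.card_eq_fintype_card, FiniteField.pow_card]
  · rwa [inv_pow, pow_right_comm]

variable {k : Type*} [Field k] [Fintype k] [Algebra k K] [NeZero n] {α : F}
  (hα : α ^ (Fintype.card k + 1) = 1) (hcard : (nthRootsFinset n (algebraMap F K α)).card = n)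
  (hYΩ : Y ⊆ nthRootsFinset n (algebraMap F K α)) (hY : ∀ ρ ∈ Y, ρ ^ Nat.card F ∈ Y)
include hα hcard hYΩ hY

theorem finrank_rootCode_dualRoots :
    Module.finrank F (rootCode F n (dualRoots (Fintype.card k) n (algebraMap F K α) Y)) =
      Y.card := by
  have hrank := finrank_rootCode (dualRoots_stable (α := α) (n := n) (Fintype.card k) hY)
    (hcard ▸ Finset.card_filter_le _ _)
  have hfilter := card_filter_conj_inv_mem (k := k) (by rw [← map_pow, hα, map_one]) hYΩ
  have hsplit := Finset.card_filter_add_card_filter_not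
    (s := nthRootsFinset n (algebraMap F K α)) fun ρ => (ρ ^ Fintype.card k)⁻¹ ∈ Y
  rw [dualRoots] at hrank ⊢
  lia

theorem finrank_rootCode_inf_dualRoots :
    Module.finrank F (rootCode F n Y ⊓
        rootCode F n (dualRoots (Fintype.card k) n (algebraMap F K α) Y) :
      Submodule F (Fin n → F)) +
        ({ρ ∈ Y | (ρ ^ Fintype.card k)⁻¹ ∈ Y} : Finset K).card = Y.card := by
  set Ω := nthRootsFinset n (algebraMap F K α)
  set D := dualRoots (Fintype.card k) n (algebraMap F K α) Y with hD
  have hinf : rootCode F n Y ⊓ rootCode F n D = rootCode F n (Y ∪ D) := by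
    ext c
    simp only [Submodule.mem_inf, mem_rootCode, Finset.mem_union, or_imp, forall_and]
  have hsub : Y ∪ D ⊆ Ω := Finset.union_subset hYΩ (Finset.filter_subset _ _)
  have hrank := finrank_rootCode (F := F) (n := n) (Y := Y ∪ D)
    (fun ρ hρ => by
      rw [Finset.mem_union] at hρ ⊢
      exact hρ.imp (hY ρ) (dualRoots_stable _ hY ρ))
    ((Finset.card_le_card hsub).trans_eq hcard)
  have hcompl : Ω \ (Y ∪ D) = ({ρ ∈ Ω | (ρ ^ Fintype.card k)⁻¹ ∈ Y} : Finset K) \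
      ({ρ ∈ Y | (ρ ^ Fintype.card k)⁻¹ ∈ Y} : Finset K) := by
    ext ρ
    simp only [hD, mem_dualRoots, Finset.mem_sdiff, Finset.mem_union, Finset.mem_filter]
    tauto
  have hfilter := card_filter_conj_inv_mem (k := k) (by rw [← map_pow, hα, map_one]) hYΩ
  have hcard1 := Finset.card_sdiff_add_card_eq_card hsub
  have hcard2 := Finset.card_sdiff_add_card_eq_card
    (Finset.filter_subset_filter (fun ρ => (ρ ^ Fintype.card k)⁻¹ ∈ Y) hYΩ)
  rw [← hcompl] at hcard2
  rw [hinf]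
  lia

end DualRoots

end Duality

section HullArithmetic

/-- The integers `t` for which `δ ^ (s + r t)` is a root of the code but not of its Hermitian
dual, if `q = 10 a + 8`. They measure how far the code is from containing its dual. -/
def hullDefectExponents (a : ℤ) : Finset ℤ := {a + 1, -a, 3 * a + 3, -3 * a - 2}

variable {a t : ℤ}

theorem mem_hullDefectExponents :
    t ∈ hullDefectExponents a ↔ t = a + 1 ∨ t = -a ∨ t = 3 * a + 3 ∨ t = -3 * a - 2 := by
  simp [hullDefectExponents]

theorem card_hullDefectExponents (ha : 0 ≤ a) : (hullDefectExponents a).card = 4 := by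
  simp only [hullDefectExponents]
  repeat rw [Finset.card_insert_of_notMem (by simp; lia)]
  rfl

-- The range of `t` and `t'` leaves only the quotients `1, …, 4`, and each of them makes `q` divide
-- an integer of absolute value less than `q`.
theorem mem_hullDefectExponents_of_dvd {t' : ℤ} (ha : 0 ≤ a)
    (ht : -(5 * a + 3) ≤ t ∧ t ≤ 5 * a + 4) (ht' : -(5 * a + 3) ≤ t' ∧ t' ≤ 5 * a + 4)
    (h : 20 * a ^ 2 + 32 * a + 13 ∣ (5 * a + 4) * (10 * a + 7) + (10 * a + 8) * t + t') :
    t ∈ hullDefectExponents a := by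
  rw [mem_hullDefectExponents]
  obtain ⟨m, hm⟩ := h
  have hm1 : 1 ≤ m := by nlinarith
  have hm4 : m ≤ 4 := by nlinarith
  have heq : ∀ τ x, (10 * a + 8) * (t - τ) = x → |x| < 10 * a + 8 → t = τ := fun τ x hx hlt =>
    sub_eq_zero.1 <| (mul_eq_zero.1
      (hx.trans (Int.eq_zero_of_abs_lt_dvd ⟨_, hx.symm⟩ hlt))).resolve_left (by lia)
  obtain rfl | rfl | rfl | rfl : m = 1 ∨ m = 2 ∨ m = 3 ∨ m = 4 := by lia
  · have := heq (-3 * a - 2) (a + 1 - t') (by linear_combination hm) (by rw [abs_lt]; lia)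
    tauto
  · have := heq (-a) (-3 * a - 2 - t') (by linear_combination hm) (by rw [abs_lt]; lia)
    tauto
  · have := heq (a + 1) (3 * a + 3 - t') (by linear_combination hm) (by rw [abs_lt]; lia)
    tauto
  · have := heq (3 * a + 3) (-a - t') (by linear_combination hm) (by rw [abs_lt]; lia)
    tauto

theorem exists_mem_hullDefectExponents_dvd (ht : t ∈ hullDefectExponents a) :
    ∃ t' ∈ hullDefectExponents a,
      20 * a ^ 2 + 32 * a + 13 ∣ (5 * a + 4) * (10 * a + 7) + (10 * a + 8) * t + t' := by
  simp only [mem_hullDefectExponents] at ht ⊢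
  rcases ht with rfl | rfl | rfl | rfl
  · exact ⟨3 * a + 3, by simp, 3, by ring⟩
  · exact ⟨-3 * a - 2, by simp, 2, by ring⟩
  · exact ⟨-a, by simp, 4, by ring⟩
  · exact ⟨a + 1, by simp, 1, by ring⟩

end HullArithmetic

section Exponents

variable {K : Type*} [Field K] {δ : K} {N : ℕ} [NeZero N] (hδ : IsPrimitiveRoot δ N)
include hδ

theorem zpow_eq_zpow_iff_dvd_sub (x y : ℤ) : δ ^ x = δ ^ y ↔ (N : ℤ) ∣ x - y := by
  have h0 : δ ≠ 0 := hδ.ne_zero (NeZero.ne N)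
  rw [← hδ.zpow_eq_one_iff_dvd, zpow_sub₀ h0, div_eq_one_iff_eq (zpow_ne_zero _ h0)]

theorem pow_val_intCast (x : ℤ) : δ ^ (x : ZMod N).val = δ ^ x := by
  rw [← zpow_natCast, zpow_eq_zpow_iff_dvd_sub hδ, ← ZMod.intCast_eq_intCast_iff_dvd_sub]
  simp

theorem pow_val_injective : Function.Injective fun i : ZMod N => δ ^ i.val := fun i j h =>
  ZMod.val_injective N (hδ.pow_inj (ZMod.val_lt i) (ZMod.val_lt j) h)

theorem mem_cyclotomicCoset_iff {Q : ℕ} {x : ℤ} {i : ZMod N} :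
    i ∈ cyclotomicCoset Q N x ↔ ∃ m : ℕ, δ ^ i.val = (δ ^ x) ^ Q ^ m := by
  refine exists_congr fun m => ?_
  have hcast : (x : ZMod N) * (Q : ZMod N) ^ m = ((x * Q ^ m : ℤ) : ZMod N) := by push_cast; rfl
  rw [← (pow_val_injective hδ).eq_iff, hcast, pow_val_intCast hδ, zpow_mul, ← Nat.cast_pow,
    zpow_natCast]

end Exponents

theorem exists_mem_exponentSet_pow_val_eq {K : Type*} [Field K] {δ ρ : K} {r n : ℕ} [NeZero r]
    [NeZero n] (hδ : IsPrimitiveRoot δ (r * n)) (hρ : ρ ^ n = δ ^ n) :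
    ∃ i ∈ exponentSet r n, δ ^ i.val = ρ := by
  have hδ0 : δ ≠ 0 := hδ.ne_zero (NeZero.ne _)
  have hδr : IsPrimitiveRoot (δ ^ r) n := hδ.pow (NeZero.pos _) rfl
  obtain ⟨j, hj, hpow⟩ := hδr.eq_pow_of_pow_eq_one (ξ := ρ / δ) (by
    rw [div_pow, hρ, div_self (pow_ne_zero _ hδ0)])
  refine ⟨_, ⟨j, hj, rfl⟩, ?_⟩
  have hval := pow_val_intCast hδ (1 + r * j : ℕ)
  rw [Int.cast_natCast] at hval
  rw [hval, zpow_natCast, pow_add, pow_one, pow_mul, hpow, mul_div_cancel₀ _ hδ0]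

section Roots

variable {K : Type*} [Field K] {δ : K} {q n s J : ℕ}

/-- The root `δ ^ (s + r t)` of `x ^ n - α`, where `r = q + 1`. -/
def rootAt (δ : K) (q s : ℕ) (t : ℤ) : K := δ ^ ((s : ℤ) + (q + 1) * t)

/-- The roots `δ ^ (s + r t)` with `-J ≤ t ≤ J + 1`. As `q ^ 2`-th powers exchange `t` and `1 - t`,
they are the powers `δ ^ i` for `i` in the defining set. -/
noncomputable def rootSet [DecidableEq K] (δ : K) (q s J : ℕ) : Finset K :=
  (Finset.Icc (-(J : ℤ)) (J + 1)).image (rootAt δ q s)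

theorem mem_rootSet [DecidableEq K] {ρ : K} : ρ ∈ rootSet δ q s J ↔
    ∃ t : ℤ, (-(J : ℤ) ≤ t ∧ t ≤ J + 1) ∧ rootAt δ q s t = ρ := by
  simp [rootSet]

variable [NeZero n] (hδ : IsPrimitiveRoot δ ((q + 1) * n))

section
include hδ

theorem rootAt_add_natCast (t : ℤ) (u : ℕ) :
    rootAt δ q s (t + u) = rootAt δ q s t * (δ ^ (q + 1)) ^ u := by
  rw [rootAt, rootAt, ← pow_mul, ← zpow_natCast, ← zpow_add₀ (hδ.ne_zero (NeZero.ne _))]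
  push_cast
  ring_nf

theorem rootAt_eq_iff (t t' : ℤ) : rootAt δ q s t = rootAt δ q s t' ↔ (n : ℤ) ∣ t - t' := by
  rw [rootAt, rootAt, zpow_eq_zpow_iff_dvd_sub hδ, add_sub_add_left_eq_sub, ← mul_sub]
  push_cast
  exact mul_dvd_mul_iff_left (by positivity)

theorem conj_inv_rootAt_eq_iff (t t' : ℤ) :
    (rootAt δ q s t ^ q)⁻¹ = rootAt δ q s t' ↔ (n : ℤ) ∣ s + q * t + t' := by
  rw [rootAt, rootAt, ← zpow_natCast, ← zpow_mul, ← zpow_neg, zpow_eq_zpow_iff_dvd_sub hδ,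
    ← dvd_neg]
  push_cast
  rw [show -(-((s + (q + 1) * t) * q) - (s + (q + 1) * t')) = (q + 1 : ℤ) * (s + q * t + t') by
    ring]
  exact mul_dvd_mul_iff_left (by positivity)

theorem rootAt_injOn (hJ : 2 * J + 1 < n) :
    Set.InjOn (rootAt δ q s) (Finset.Icc (-(J : ℤ)) (J + 1)) := by
  intro t ht t' ht' h
  rw [Finset.coe_Icc, Set.mem_Icc] at ht ht'
  rw [rootAt_eq_iff hδ] at h
  exact sub_eq_zero.1 (Int.eq_zero_of_abs_lt_dvd h (by rw [abs_lt]; omega))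

theorem card_rootSet [DecidableEq K] (hJ : 2 * J + 1 < n) :
    (rootSet δ q s J).card = 2 * J + 2 := by
  rw [rootSet, Finset.card_image_of_injOn (rootAt_injOn hδ hJ), Int.card_Icc]
  lia

theorem card_filter_rootSet [DecidableEq K] (hq : q ≡ 8 [MOD 10]) (hn : 5 * n = q ^ 2 + 1)
    (hs : 2 * s + q = q ^ 2) (hJ : 2 * J + 2 ≤ q) (hJ' : 3 * q ≤ 10 * J + 4) :
    ({ρ ∈ rootSet δ q s J | (ρ ^ q)⁻¹ ∈ rootSet δ q s J} : Finset K).card = 4 := by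
  obtain ⟨a, rfl⟩ : ∃ a, q = 10 * a + 8 := ⟨q / 10, by unfold Nat.ModEq at hq; lia⟩
  have hdvd : ∀ t t' : ℤ, (rootAt δ (10 * a + 8) s t ^ (10 * a + 8))⁻¹ =
      rootAt δ (10 * a + 8) s t' ↔
      20 * (a : ℤ) ^ 2 + 32 * a + 13 ∣ (5 * a + 4) * (10 * a + 7) + (10 * a + 8) * t + t' :=
    fun t t' => by
      rw [conj_inv_rootAt_eq_iff hδ, show n = 20 * a ^ 2 + 32 * a + 13 by linarith,
        show s = (5 * a + 4) * (10 * a + 7) by linarith]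
      push_cast
      rfl
  have hrange : ∀ t ∈ hullDefectExponents a, -(J : ℤ) ≤ t ∧ t ≤ J + 1 := fun t ht => by
    rw [mem_hullDefectExponents] at ht
    lia
  have himage : ({ρ ∈ rootSet δ (10 * a + 8) s J | (ρ ^ (10 * a + 8))⁻¹ ∈
      rootSet δ (10 * a + 8) s J} : Finset K) =
      (hullDefectExponents a).image (rootAt δ (10 * a + 8) s) := by
    ext ρ
    rw [Finset.mem_filter, Finset.mem_image, mem_rootSet, mem_rootSet]
    constructor
    · rintro ⟨⟨t, ht, rfl⟩, t', ht', h⟩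
      exact ⟨t, mem_hullDefectExponents_of_dvd (Int.natCast_nonneg a) (by lia) (by lia)
        ((hdvd t t').1 h.symm), rfl⟩
    · rintro ⟨t, ht, rfl⟩
      obtain ⟨t', ht', h⟩ := exists_mem_hullDefectExponents_dvd ht
      exact ⟨⟨t, hrange t ht, rfl⟩, t', hrange t' ht', ((hdvd t t').2 h).symm⟩
  have hinj : Set.InjOn (rootAt δ (10 * a + 8) s) (hullDefectExponents a) :=
    (rootAt_injOn hδ (J := J) (by nlinarith)).mono fun t ht => by simpa using hrange t ht
  rw [himage, Finset.card_image_of_injOn hinj, card_hullDefectExponents (Int.natCast_nonneg a)]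

end

section Stability
include hδ

variable (hq : Even q) (hs : 2 * s + q = q ^ 2)
include hq hs

theorem rootAt_pow_length (t : ℤ) : rootAt δ q s t ^ n = δ ^ n := by
  obtain ⟨m, rfl⟩ := hq
  have hs' : 2 * (s : ℤ) + (m + m) = (m + m) ^ 2 := mod_cast hs
  rw [rootAt, ← zpow_natCast, ← zpow_natCast, ← zpow_mul, zpow_eq_zpow_iff_dvd_sub hδ]
  refine ⟨m - 1 + t, ?_⟩
  have hs'' : (s : ℤ) = 2 * m ^ 2 - m := by linarith [hs']
  rw [hs'']
  push_cast
  ring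

variable (hn : 5 * n = q ^ 2 + 1)
include hn

theorem rootAt_pow_sq (t : ℤ) : rootAt δ q s t ^ q ^ 2 = rootAt δ q s (1 - t) := by
  obtain ⟨m, rfl⟩ := hq
  have hn' : 5 * (n : ℤ) = (m + m) ^ 2 + 1 := mod_cast hn
  have hs' : 2 * (s : ℤ) + (m + m) = (m + m) ^ 2 := mod_cast hs
  rw [rootAt, rootAt, ← zpow_natCast, ← zpow_mul, zpow_eq_zpow_iff_dvd_sub hδ]
  refine ⟨5 * (m - 1 + t), ?_⟩
  have hs'' : (s : ℤ) = 2 * m ^ 2 - m := by linarith [hs']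
  rw [hs'']
  push_cast
  linear_combination (-(2 * m + 1) * (m - 1 + t)) * hn'

theorem rootSet_stable [DecidableEq K] {ρ : K} (hρ : ρ ∈ rootSet δ q s J) :
    ρ ^ q ^ 2 ∈ rootSet δ q s J := by
  obtain ⟨t, ht, rfl⟩ := mem_rootSet.1 hρ
  exact mem_rootSet.2 ⟨1 - t, by lia, (rootAt_pow_sq hδ hq hs hn t).symm⟩

theorem pow_val_mem_rootSet_iff [DecidableEq K] {i : ZMod ((q + 1) * n)} :
    δ ^ i.val ∈ rootSet δ q s J ↔ i ∈ cosetUnion q (q + 1) n s J := by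
  have hcoset : ∀ j : ℕ, i ∈ cyclotomicCoset (q ^ 2) ((q + 1) * n) (s - (q + 1 : ℕ) * j) ↔
      ∃ m : ℕ, δ ^ i.val = rootAt δ q s (-j) ^ (q ^ 2) ^ m := fun j => by
    rw [mem_cyclotomicCoset_iff hδ, rootAt]
    push_cast
    ring_nf
  simp only [cosetUnion, Set.mem_iUnion, Set.mem_Icc, exists_prop, hcoset]
  constructor
  · intro h
    obtain ⟨t, ht, h⟩ := mem_rootSet.1 h
    rcases le_or_gt t 0 with hneg | hpos
    · exact ⟨t.natAbs, by lia, 0, by rw [pow_zero, pow_one, ← h]; congr 1; lia⟩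
    · refine ⟨(t - 1).natAbs, by lia, 1, ?_⟩
      rw [pow_one, rootAt_pow_sq hδ hq hs hn, ← h]
      congr 1
      lia
  · rintro ⟨j, hj, m, h⟩
    rw [h]
    clear h
    induction m with
    | zero => exact mem_rootSet.2 ⟨-j, by lia, by rw [pow_zero, pow_one]⟩
    | succ m ih =>
      rw [pow_succ, pow_mul]
      exact rootSet_stable hδ hq hs hn ih

end Stability

end Roots

theorem exists_subfield_natCard_eq {F : Type*} [Field F] {p e d : ℕ} [Fact p.Prime]
    (hF : Nat.card F = (p ^ e) ^ d) :
    ∃ k : Subfield F, Nat.card k = p ^ e ∧ Module.finrank k F = d := by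
  have hp : 1 < p := (Fact.out : p.Prime).one_lt
  have : Finite F := Nat.finite_of_card_ne_zero (by rw [hF]; positivity)
  have : Fintype F := Fintype.ofFinite F
  have he : e ≠ 0 := by
    rintro rfl
    have hone : 1 < Nat.card F := Finite.one_lt_card
    rw [hF, pow_zero, one_pow] at hone
    exact hone.false
  have hcard : Nat.card F = p ^ (e * d) := by rw [hF, pow_mul]
  have : CharP F p := charP_of_card_eq_prime_pow (by rw [Fintype.card_eq_nat_card, hcard])
  let := ZMod.algebra F p
  have hrank : Module.finrank (ZMod p) F = e * d := Nat.pow_right_injective hp <| by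
    simpa only [Nat.card_zmod, hcard] using
      (Module.natCard_eq_pow_finrank (K := ZMod p) (V := F)).symm
  obtain ⟨φ⟩ := FiniteField.nonempty_algHom_of_finrank_dvd (F := ZMod p) (K := GaloisField p e)
    (L := F) (by rw [GaloisField.finrank p he, hrank]; exact dvd_mul_right e d)
  have hk : Nat.card (φ : GaloisField p e →+* F).fieldRange = p ^ e := by
    rw [← GaloisField.card p e he]
    exact (Nat.card_congr (RingHom.rangeRestrictFieldEquiv _).toEquiv).symm
  refine ⟨_, hk, Nat.pow_right_injective (Nat.one_lt_pow he hp) ?_⟩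
  simpa only [hk, hF] using
    (Module.natCard_eq_pow_finrank (K := (φ : GaloisField p e →+* F).fieldRange) (V := F)).symm

theorem card_nthRootsFinset_pow {K : Type*} [Field K] {n : ℕ} {θ δ : K}
    (hθ : IsPrimitiveRoot θ n) (hδ : δ ≠ 0) : (Polynomial.nthRootsFinset n (δ ^ n)).card = n := by
  classical
  rw [Polynomial.nthRootsFinset_def,
    Multiset.toFinset_card_of_nodup (hθ.nthRoots_nodup (pow_ne_zero n hδ)), hθ.card_nthRoots,
    if_pos ⟨δ, rfl⟩]

section CosetCode

open Polynomial

section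
variable {q n J : ℕ} (hq : q ≡ 8 [MOD 10])
include hq

theorem even_of_modEq_eight : Even q := Nat.even_iff.2 (by unfold Nat.ModEq at hq; lia)

theorem two_mul_add_one_lt (hn : 5 * n = q ^ 2 + 1) (hJ : 2 * J + 2 ≤ q) : 2 * J + 1 < n := by
  have : 8 ≤ q := by unfold Nat.ModEq at hq; lia
  nlinarith

theorem four_mul_add_one_le (hn : 5 * n = q ^ 2 + 1) (hJ : 2 * J + 2 ≤ q) : 4 * J + 1 ≤ n := by
  have : 8 ≤ q := by unfold Nat.ModEq at hq; lia
  nlinarith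

theorem four_mul_add_four_le {lam : ℕ} (hn : 5 * n = q ^ 2 + 1) (hlam : 5 * lam ≤ q + 2)
    (hJ : 10 * J + 14 = 3 * q + 10 * lam) (hne : ¬ (q = 8 ∧ lam = 2)) : 4 * J + 4 ≤ n := by
  obtain rfl | hq' : q = 8 ∨ 18 ≤ q := by unfold Nat.ModEq at hq; lia
  · lia
  · nlinarith

end

variable {F K : Type*} [Field F] [Field K] [Algebra F K] {q n s J : ℕ} [NeZero n]
  {α : F} {δ : K} (hδ : IsPrimitiveRoot δ ((q + 1) * n))

section
variable (hδα : δ ^ n = algebraMap F K α)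
include hδ hδα

omit [NeZero n] in
theorem pow_succ_eq_one : α ^ (q + 1) = 1 := by
  refine FaithfulSMul.algebraMap_injective F K ?_
  rw [map_pow, map_one, ← hδα, ← pow_mul, mul_comm, hδ.pow_eq_one]

theorem card_nthRootsFinset_algebraMap : (nthRootsFinset n (algebraMap F K α)).card = n :=
  hδα ▸ card_nthRootsFinset_pow (hδ.pow (NeZero.pos _) rfl) (hδ.ne_zero (NeZero.ne _))

end

section DefiningSet

variable (hq : Even q) (hs : 2 * s + q = q ^ 2) (hδα : δ ^ n = algebraMap F K α)
include hδ hq hs hδα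

theorem rootSet_subset_nthRootsFinset [DecidableEq K] :
    rootSet δ q s J ⊆ nthRootsFinset n (algebraMap F K α) := by
  intro ρ hρ
  obtain ⟨t, -, rfl⟩ := mem_rootSet.1 hρ
  rw [mem_nthRootsFinset (NeZero.pos n), rootAt_pow_length hδ hq hs, hδα]

variable (hn : 5 * n = q ^ 2 + 1)
include hn

theorem exists_hasDefiningSet [Finite F] (hF : Nat.card F = q ^ 2) :
    ∃ C : Submodule F (Fin n → F), IsConstacyclic α C ∧
      HasDefiningSet α δ (q + 1) C (cosetUnion q (q + 1) n s J) := by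
  classical
  have hY : ∀ ρ ∈ rootSet δ q s J, ρ ^ n = algebraMap F K α := fun ρ hρ =>
    (mem_nthRootsFinset (NeZero.pos n) _).1 (rootSet_subset_nthRootsFinset hδ hq hs hδα hρ)
  obtain ⟨g, hmonic, hg⟩ := exists_map_eq_prod (F := F) (rootSet δ q s J) fun ρ hρ =>
    hF ▸ rootSet_stable hδ hq hs hn hρ
  refine ⟨_, rootCode_isConstacyclic hY, g, isGeneratorPoly_rootCode hg hmonic hY, ?_⟩
  ext i
  have hroot : aeval (δ ^ i.val) g = 0 ↔ δ ^ i.val ∈ rootSet δ q s J := by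
    rw [← eval_map_algebraMap, hg, eval_prod, Finset.prod_eq_zero_iff]
    simp only [eval_sub, eval_X, eval_C, sub_eq_zero, exists_eq_right']
  rw [Set.mem_ofPred_eq, hroot, ← pow_val_mem_rootSet_iff hδ hq hs hn, iff_and_self]
  intro h
  obtain ⟨j, hj, hji⟩ := exists_mem_exponentSet_pow_val_eq hδ ((hY _ h).trans hδα.symm)
  rwa [← pow_val_injective hδ hji]

theorem eq_rootCode_of_hasDefiningSet [DecidableEq K] {C : Submodule F (Fin n → F)}
    (hC : HasDefiningSet α δ (q + 1) C (cosetUnion q (q + 1) n s J)) :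
    C = rootCode F n (rootSet δ q s J) := by
  obtain ⟨g, hg, hZ⟩ := hC
  refine hg.eq_rootCode (fun ρ => (mem_nthRootsFinset (NeZero.pos n) _).1)
    (card_nthRootsFinset_algebraMap hδ hδα) (rootSet_subset_nthRootsFinset hδ hq hs hδα)
    fun ρ hρ => ?_
  rw [mem_nthRootsFinset (NeZero.pos n), ← hδα] at hρ
  obtain ⟨i, hi, rfl⟩ := exists_mem_exponentSet_pow_val_eq hδ hρ
  rw [pow_val_mem_rootSet_iff hδ hq hs hn, hZ]
  exact ⟨fun h => ⟨hi, h⟩, fun h => h.2⟩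

end DefiningSet

variable [DecidableEq K]

include hδ in
theorem lt_hammingNorm_of_mem_rootCode_rootSet [DecidableEq F] {c : Fin n → F}
    (hc : c ∈ rootCode F n (rootSet δ q s J)) (hc0 : c ≠ 0) : 2 * J + 2 < hammingNorm c := by
  have hγ : rootAt δ q s (-J) ≠ 0 := zpow_ne_zero _ (hδ.ne_zero (NeZero.ne _))
  refine lt_hammingNorm_of_roots (hδ.pow (NeZero.pos _) rfl) hγ hc0 fun u hu => ?_
  rw [← rootAt_add_natCast hδ]
  exact mem_rootCode.1 hc _ (mem_rootSet.2 ⟨-J + u, by lia, rfl⟩)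

variable [Finite F] (hF : Nat.card F = q ^ 2) (hq : q ≡ 8 [MOD 10]) (hn : 5 * n = q ^ 2 + 1)
  (hs : 2 * s + q = q ^ 2) (hJ : 2 * J + 2 ≤ q)

section
include hδ hF hq hn hs hJ

theorem finrank_rootCode_rootSet :
    Module.finrank F (rootCode F n (rootSet δ q s J)) + (2 * J + 2) = n := by
  have hlt := two_mul_add_one_lt hq hn hJ
  have hcard := card_rootSet (s := s) hδ hlt
  rw [← hcard]
  exact finrank_rootCode (fun ρ hρ => hF ▸ rootSet_stable hδ (even_of_modEq_eight hq) hs hn hρ)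
    (by lia)

end

/-- The Hermitian dual of `rootCode F n (rootSet δ q s J)`, described by its roots. -/
noncomputable def rootSetDual (α : F) (δ : K) (q n s J : ℕ) : Submodule F (Fin n → F) :=
  rootCode F n (dualRoots q n (algebraMap F K α) (rootSet δ q s J))

variable (hδα : δ ^ n = algebraMap F K α)
  {k : Type*} [Field k] [Fintype k] (hk : Fintype.card k = q)

section
variable [Algebra k K]
include hδ hδα hk

omit [Finite F] in
theorem sum_mul_pow_eq_zero_of_mem_rootSetDual {c d : Fin n → F}
    (hc : c ∈ rootCode F n (rootSet δ q s J)) (hd : d ∈ rootSetDual α δ q n s J) :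
    ∑ i, c i * d i ^ q = 0 := by
  subst hk
  have hθ : IsPrimitiveRoot (δ ^ (Fintype.card k + 1)) n := hδ.pow (NeZero.pos _) rfl
  exact sum_mul_pow_card_eq_zero_of_mem_rootCode hθ (card_nthRootsFinset_algebraMap hδ hδα)
    (hδα ▸ pow_ne_zero n (hδ.ne_zero (NeZero.ne _))) hc hd

include hF hq hn hs hJ

theorem finrank_rootSetDual : Module.finrank F (rootSetDual α δ q n s J) = 2 * J + 2 := by
  subst hk
  have heven := even_of_modEq_eight hq
  rw [← card_rootSet (s := s) hδ (two_mul_add_one_lt hq hn hJ)]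
  exact finrank_rootCode_dualRoots (pow_succ_eq_one hδ hδα) (card_nthRootsFinset_algebraMap hδ hδα)
    (rootSet_subset_nthRootsFinset hδ heven hs hδα)
    fun ρ hρ => hF ▸ rootSet_stable hδ heven hs hn hρ

theorem finrank_inf_rootSetDual (hJ' : 3 * q ≤ 10 * J + 4) :
    Module.finrank F (rootCode F n (rootSet δ q s J) ⊓ rootSetDual α δ q n s J :
      Submodule F (Fin n → F)) + 4 = 2 * J + 2 := by
  subst hk
  have heven := even_of_modEq_eight hq
  rw [← card_rootSet (s := s) hδ (two_mul_add_one_lt hq hn hJ),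
    ← card_filter_rootSet hδ hq hn hs hJ hJ']
  exact finrank_rootCode_inf_dualRoots (pow_succ_eq_one hδ hδα)
    (card_nthRootsFinset_algebraMap hδ hδα) (rootSet_subset_nthRootsFinset hδ heven hs hδα)
    fun ρ hρ => hF ▸ rootSet_stable hδ heven hs hn hρ

variable (hJ' : 3 * q ≤ 10 * J + 4)
include hJ'

theorem exists_mem_not_mem_rootSetDual [DecidableEq F] :
    ∃ c ∈ rootCode F n (rootSet δ q s J), c ∉ rootSetDual α δ q n s J ∧
      hammingNorm c = 2 * J + 3 := by
  have hdim := finrank_rootCode_rootSet hδ hF hq hn hs hJ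
  refine exists_min_weight_not_mem hdim
    (fun c => lt_hammingNorm_of_mem_rootCode_rootSet hδ) fun hle => ?_
  have hinf := finrank_inf_rootSetDual hδ hF hq hn hs hJ hδα hk hJ'
  have hlen := four_mul_add_one_le hq hn hJ
  rw [inf_eq_left.2 hle] at hinf
  lia

theorem isMinWeight_rootCode_rootSet [DecidableEq F] :
    IsMinWeight (rootCode F n (rootSet δ q s J)) (2 * J + 3) := by
  obtain ⟨c, hc, hcD, hcw⟩ := exists_mem_not_mem_rootSetDual hδ hF hq hn hs hJ hδα hk hJ'
  refine ⟨⟨c, hc, fun h => hcD (h ▸ Submodule.zero_mem _), hcw⟩, ?_⟩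
  rintro w ⟨c, hc, hc0, rfl⟩
  exact lt_hammingNorm_of_mem_rootCode_rootSet hδ hc hc0

variable [Algebra k F] (h2 : Module.finrank k F = 2)
include h2

theorem rank_mul_hermTranspose_eq_four {m : ℕ} {H : Matrix (Fin m) (Fin n) F}
    (hH : IsParityCheck (rootCode F n (rootSet δ q s J)) H) :
    (H * hermTranspose q H).rank = 4 := by
  subst hk
  have hdim := finrank_rootCode_rootSet hδ hF hq hn hs hJ
  have hdual := finrank_rootSetDual hδ hF hq hn hs hJ hδα (k := k) rfl
  have hinf := finrank_inf_rootSetDual hδ hF hq hn hs hJ hδα (k := k) rfl hJ'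
  have hrank := rank_mul_hermTranspose h2 (by rw [hdual, hdim])
    (fun c hc d => sum_mul_pow_eq_zero_of_mem_rootSetDual hδ hδα rfl hc) hH
  lia

omit [DecidableEq K] in
theorem existsEAQEC_rootSet : ExistsEAQEC q n (n - 4 * J) (2 * J + 3) 4 := by
  classical
  subst hk
  have hdim := finrank_rootCode_rootSet hδ hF hq hn hs hJ
  have hdual := finrank_rootSetDual hδ hF hq hn hs hJ hδα (k := k) rfl
  have hinf := finrank_inf_rootSetDual hδ hF hq hn hs hJ hδα (k := k) rfl hJ'
  have hlen := four_mul_add_one_le hq hn hJ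
  exact existsEAQEC_of_hermitian h2 (by rw [hdual, hdim])
    (fun c hc d => sum_mul_pow_eq_zero_of_mem_rootSetDual hδ hδα rfl hc) (by lia) (by lia)
    (fun c => lt_hammingNorm_of_mem_rootCode_rootSet hδ)
    (exists_mem_not_mem_rootSetDual hδ hF hq hn hs hJ hδα rfl hJ')

end

end CosetCode

end EAQ

theorem mainTheorem6 (e q n lam : ℕ) (hq : q = 2 ^ e) (hq8 : q ≡ 8 [MOD 10])
    (hn : 5 * n = q ^ 2 + 1) (hlam : 1 ≤ lam) (hlam' : 5 * lam ≤ q + 2)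
    {F : Type*} [Field F] [DecidableEq F] (hF : Nat.card F = q ^ 2)
    {K : Type*} [Field K] [Algebra F K]
    (α : F) (hα : IsPrimitiveRoot α (q + 1))
    (δ : K) (hδ : IsPrimitiveRoot δ ((q + 1) * n)) (hδα : δ ^ n = algebraMap F K α)
    (s J : ℕ) (hs : 2 * s = q ^ 2 - q) (hJ : 10 * J + 14 = 3 * q + 10 * lam) :
    (∃ C : Submodule F (Fin n → F), EAQ.IsConstacyclic α C ∧
      EAQ.HasDefiningSet α δ (q + 1) C (EAQ.cosetUnion q (q + 1) n s J)) ∧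
    ∀ C : Submodule F (Fin n → F), EAQ.IsConstacyclic α C →
      EAQ.HasDefiningSet α δ (q + 1) C (EAQ.cosetUnion q (q + 1) n s J) →
      ∃ k d : ℕ,
        (k : ℚ) = n - 2 / 5 * (3 * q - 14) - 4 * lam ∧
        (d : ℚ) = (3 * q - 14) / 5 + 2 * lam + 3 ∧
        -- the parameters are those that the Hermitian construction assigns to `C`
        (k : ℤ) = 2 * (Module.finrank F C : ℤ) - n + 4 ∧
        EAQ.IsMinWeight C d ∧
        (∀ (m : ℕ) (H : Matrix (Fin m) (Fin n) F), EAQ.IsParityCheck C H →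
          (H * EAQ.hermTranspose q H).rank = 4) ∧
        -- the quantum code exists and attains the entanglement-assisted Singleton bound
        EAQ.ExistsEAQEC q n k d 4 ∧
        (n : ℤ) + 4 - k = 2 * ((d : ℤ) - 1) ∧
        (¬ (q = 8 ∧ lam = 2) → (d : ℚ) ≤ (n + 2) / 2) := by
  classical
  have : Fact (Nat.Prime 2) := ⟨Nat.prime_two⟩
  have : Finite F := Nat.finite_of_card_ne_zero (by rw [hF, hq]; positivity)
  have : NeZero n := ⟨by rintro rfl; lia⟩
  obtain ⟨k, hk, h2⟩ := EAQ.exists_subfield_natCard_eq (p := 2) (e := e) (by rw [hF, hq])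
  have : Fintype k := Fintype.ofFinite k
  replace hk : Fintype.card k = q := by rw [Fintype.card_eq_nat_card, hk, hq]
  have hs' : 2 * s + q = q ^ 2 := by have := Nat.le_self_pow two_ne_zero q; lia
  obtain ⟨hJq, hJq'⟩ : 2 * J + 2 ≤ q ∧ 3 * q ≤ 10 * J + 4 := by lia
  have heven := EAQ.even_of_modEq_eight hq8
  have hlen := EAQ.four_mul_add_one_le hq8 hn hJq
  have hJℚ : 10 * (J : ℚ) + 14 = 3 * q + 10 * lam := mod_cast hJ
  refine ⟨EAQ.exists_hasDefiningSet hδ heven hs' hδα hn hF, fun C _ hC => ?_⟩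
  obtain rfl := EAQ.eq_rootCode_of_hasDefiningSet hδ heven hs' hδα hn hC
  have hdim := EAQ.finrank_rootCode_rootSet hδ hF hq8 hn hs' hJq
  refine ⟨n - 4 * J, 2 * J + 3, ?_, ?_, by lia,
    EAQ.isMinWeight_rootCode_rootSet hδ hF hq8 hn hs' hJq hδα hk hJq',
    fun _ _ => EAQ.rank_mul_hermTranspose_eq_four hδ hF hq8 hn hs' hJq hδα hk hJq' h2,
    EAQ.existsEAQEC_rootSet hδ hF hq8 hn hs' hJq hδα hk hJq' h2, by lia, fun hne => ?_⟩
  · rw [Nat.cast_sub (by lia)]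
    push_cast
    linarith
  · push_cast
    linarith
  · have : 4 * (J : ℚ) + 4 ≤ n := mod_cast EAQ.four_mul_add_four_le hq8 hn hlam' hJ hne
    push_cast
    linarith
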